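/- Let $\int_{\mathbb{R}^m} p(x)\,(2\pi)^{-m/2}\,\mathrm{d}^m x = 1$ be the normalization of the probability density $p$ of a random variable $X$ with values in $\mathbb{R}^m$, and let $S(X) = -\mathbb{E}\ln p(X)$ be its Shannon differential entropy. For an ordered family $\mathbf{B}=(B_1,\dots,B_K)$ of real matrices, where $B_i$ has size $m_i\times m$ and rank $m_i$, and for $\mathbf{p}\in\mathbb{R}_{\ge 0}^K$, the Brascamp--Lieb constant is $$f(\mathbf{B},\mathbf{p}) = \sup_X\Big(S(X)-\sum_{i=1}^K p_i\,S(B_iX)\Big)\in[-\infty,\infty],$$ where the supremum is over all random variables $X$ with values in $\mathbb{R}^m$ and finite Shannon differential entropy for which the expression is well defined in $[-\infty,\infty]$, i.e. $S(B_iX)$ exists in $[-\infty,\infty]$ for every $i$ with $p_i\neq 0$, and these entropies do not take both values $+\infty$ and $-\infty$ (terms with $p_i=0$ are $0$). Let $n\ge 1$, let $m=2n$, and consider the datum $\mathbf{B}^0=(B^0_1,B^0_2,B^0_3)$ of $n\times 2n$ matrices $$B^0_1=\begin{pmatrix} I_n & 0\end{pmatrix},\qquad B^0_2=\begin{pmatrix}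 0 & I_n\end{pmatrix},\qquad B^0_3=\begin{pmatrix} I_n & I_n\end{pmatrix}.$$ Then, for every $\mathbf{p}\in\mathbb{R}_{\ge 0}^3$, with the convention $0\ln 0=0$, $$f(\mathbf{B}^0,\mathbf{p})=\frac n2\sum_{i=1}^3\big((1-p_i)\ln(1-p_i)-p_i\ln p_i\big)$$ if $\mathbf{p}\in[0,1]^3$ and $p_1+p_2+p_3=2$, and $f(\mathbf{B}^0,\mathbf{p})=\infty$ otherwise. -/

import Mathlib

open MeasureTheory
open scoped ENNReal

namespace BrascampLieb

noncomputable section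

/-- The reference measure `dx / (2π)^(n/2)` on `ℝ^ι`, where `n` is the cardinality of `ι`. -/
def refMeasure (ι : Type) [Fintype ι] : Measure (ι → ℝ) :=
  ENNReal.ofReal ((2 * Real.pi) ^ (-(Fintype.card ι : ℝ) / 2)) • (volume : Measure (ι → ℝ))

section Entropy

variable {ι : Type} [Fintype ι]

/-- The probability density of the law `μ` with respect to the reference measure
(meaningful when `μ ≪ refMeasure ι`). -/
def density (μ : Measure (ι → ℝ)) (x : ι → ℝ) : ℝ :=
  (μ.rnDeriv (refMeasure ι) x).toReal

/-- The expectation of the positive part of `- ln p(X)`, where `X` has law `μ` and density `p`. -/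
def entropyPos (μ : Measure (ι → ℝ)) : ℝ≥0∞ :=
  ∫⁻ x, ENNReal.ofReal (-Real.log (density μ x)) ∂μ

/-- The expectation of the negative part of `- ln p(X)`, where `X` has law `μ` and density `p`. -/
def entropyNeg (μ : Measure (ι → ℝ)) : ℝ≥0∞ :=
  ∫⁻ x, ENNReal.ofReal (Real.log (density μ x)) ∂μ

/-- The Shannon differential entropy `S(X) = - E[ln p(X)]` exists in `[-∞, ∞]`: the law `μ` of `X`
has a density, and the positive and negative parts of `- ln p(X)` do not both have infinite
expectation. -/
def HasEntropy (μ : Measure (ι → ℝ)) : Prop :=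
  μ ≪ refMeasure ι ∧ (entropyPos μ ≠ ⊤ ∨ entropyNeg μ ≠ ⊤)

/-- The Shannon differential entropy exists and is finite. -/
def HasFiniteEntropy (μ : Measure (ι → ℝ)) : Prop :=
  μ ≪ refMeasure ι ∧ entropyPos μ ≠ ⊤ ∧ entropyNeg μ ≠ ⊤

/-- The Shannon differential entropy `S(X) = - E[ln p(X)]` of a random variable `X` with law `μ`
(meaningful when `HasEntropy μ`). -/
def entropy (μ : Measure (ι → ℝ)) : EReal :=
  (entropyPos μ : EReal) - (entropyNeg μ : EReal)

end Entropy

/-- A Brascamp-Lieb datum: an ordered family of `K` real matrices, the `i`-th of size `n_i × n` and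
of rank `n_i`. Rows and columns are indexed by finite types with `n_i` and `n` elements. -/
structure Datum {K : ℕ} (ι : Type) [Fintype ι] (κ : Fin K → Type) [∀ i, Fintype (κ i)] where
  mat : ∀ i, Matrix (κ i) ι ℝ
  rank_eq : ∀ i, (mat i).rank = Fintype.card (κ i)

section Constant

variable {K : ℕ} {ι : Type} [Fintype ι] {κ : Fin K → Type} [∀ i, Fintype (κ i)]

/-- The law of `B_i X`, where `X` has law `μ`. -/
def Datum.image (B : Datum ι κ) (i : Fin K) (μ : Measure (ι → ℝ)) : Measure (κ i → ℝ) :=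
  μ.map (fun x => (B.mat i).mulVec x)

/-- The laws `μ` of the random variables `X` over which the supremum is taken: `X` has finite
Shannon differential entropy, and `S(X) - ∑ i, p_i S(B_i X)` is a meaningful expression in
`[-∞, ∞]`, i.e. the entropies `S(B_i X)` with `p_i ≠ 0` exist in `[-∞, ∞]` and do not take both of
the values `∞` and `-∞`. -/
structure Datum.Admissible (B : Datum ι κ) (p : Fin K → ℝ) (μ : Measure (ι → ℝ)) : Prop where
  isProbabilityMeasure : IsProbabilityMeasure μ
  hasFiniteEntropy : HasFiniteEntropy μ
  hasEntropy_image : ∀ i, p i ≠ 0 → HasEntropy (B.image i μ)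
  not_indeterminate : ¬ ∃ i j, p i ≠ 0 ∧ p j ≠ 0 ∧
    entropy (B.image i μ) = ⊤ ∧ entropy (B.image j μ) = ⊥

/-- The Brascamp-Lieb constant `f(B, p) = sup_X (S(X) - ∑ i, p_i S(B_i X))`, for `p ≥ 0`. -/
def Datum.constant (B : Datum ι κ) (p : Fin K → ℝ) : EReal :=
  ⨆ (μ : Measure (ι → ℝ)) (_ : B.Admissible p μ),
    (entropy μ - ∑ i, (p i : EReal) * entropy (B.image i μ))

end Constant

/-- A matrix with a right inverse has full row rank. -/
theorem rank_of_mul_eq_one {m k : Type} [Fintype m] [DecidableEq m] [Fintype k]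
    (A : Matrix m k ℝ) (C : Matrix k m ℝ) (h : A * C = 1) : A.rank = Fintype.card m := by
  refine le_antisymm A.rank_le_card_height ?_
  have h1 := Matrix.rank_mul_le_left A C
  rwa [h, Matrix.rank_one] at h1

/-- The datum `(I_n 0)`, `(0 I_n)`, `(I_n I_n)` on `ℝ^(2n)`. -/
def standardDatum (n : ℕ) : Datum (K := 3) (Fin n ⊕ Fin n) (fun _ => Fin n) where
  mat := ![Matrix.fromCols 1 0, Matrix.fromCols 0 1, Matrix.fromCols 1 1]
  rank_eq := by
    intro i
    fin_cases i
    · exact rank_of_mul_eq_one _ (Matrix.fromRows 1 0) (by simp [Matrix.fromCols_mul_fromRows])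
    · exact rank_of_mul_eq_one _ (Matrix.fromRows 0 1) (by simp [Matrix.fromCols_mul_fromRows])
    · exact rank_of_mul_eq_one _ (Matrix.fromRows 1 0) (by simp [Matrix.fromCols_mul_fromRows])

end

end BrascampLieb

/-!
The upper bound is dual to the sharp Young inequality. By Gibbs' inequality, `S(X) - ∑ p_i S(X_i)`
is at most the logarithm of the integral of `∏ f_i(B_i x) ^ p_i`, where `f_i` is the density of
`X_i = B_i X`, so it suffices to bound this integral by the constant for arbitrary densities
`f_i`. Working with the positive part of the logarithm also settles the laws whose marginal
entropies are infinite (`integrable_and_sum_integral_le_log`, `constant_standardDatum_le`).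

The sharp Young inequality on the line is proved by mass transport, following Barthe. Let `T_i` be
the monotone map that transports `f_i` to the standard Gaussian density
(`exists_gaussian_transport`), let `v_i` be the vectors `(1, 0)`, `(0, 1)`, `(1, 1)`, and let
`Θ(z) = ∑ p_i c_i T_i(⟨z, v_i⟩) v_i` with positive factors `c_i`. The map `Θ` is injective,
because it is monotone, and its Jacobian is a positive combination of the products `T_i' T_j'`,
which the inequality of arithmetic and geometric means bounds below by a multiple of
`∏ (T_i') ^ p_i` (`exp_neg_logConst_mul_le_pairSum`). On the other hand, `∏ exp(-T_i ^ 2 / 2) ^ p_i` is at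
most a Gaussian function of `Θ` (`quadForm_le_pairSum_mul`), whose integral is explicit.
Optimizing over the `c_i` gives the sharp constant, as a limit when `p` lies on the boundary of
the cube (`exists_scaling`). The inequality then tensorizes (`YoungBound.prod`).

The lower bounds come from Gaussian laws. For a probability vector `q` with positive entries, let
the pair `(X_0, X_1)` have, in each coordinate, the covariance of the first two components of a
multinomial vector with probabilities `q_i`. Then the variances of `X_0`, `X_1` and
`X_2 = X_0 + X_1` are `q_i (1 - q_i)` and the covariance matrix has determinant `q_0 q_1 q_2`
(`crossLog_le_constant`). Letting `q` tend to `1 - p` yields the constant. If `∑ p_i ≠ 2`,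
dilating one of these laws makes the functional unbounded, and if some `p_k > 1`, letting `q_k`
tend to `0` does.
-/

namespace BrascampLieb

/-! ### The algebra of the constant -/

/-- Twice the Brascamp-Lieb constant for `n = 1`, when `p` is in the cube and has sum `2`. -/
noncomputable def logConst (p : Fin 3 → ℝ) : ℝ :=
  ∑ i, ((1 - p i) * Real.log (1 - p i) - p i * Real.log (p i))

/-- The determinant of `∑ i, p i * t i * v i * (v i)ᵀ`, where `v 0 = (1, 0)`, `v 1 = (0, 1)` and
`v 2 = (1, 1)`. -/
def pairSum (p t : Fin 3 → ℝ) : ℝ :=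
  p 0 * p 1 * (t 0 * t 1) + p 0 * p 2 * (t 0 * t 2) + p 1 * p 2 * (t 1 * t 2)

theorem exp_mul_log_eq_rpow {x : ℝ} (hx : 0 ≤ x) : Real.exp (x * Real.log x) = x ^ x := by
  rcases hx.eq_or_lt with rfl | h
  · simp
  · rw [Real.rpow_def_of_pos h, mul_comm]

theorem exp_neg_logConst {p : Fin 3 → ℝ} (hp : ∀ i, p i ∈ Set.Icc (0 : ℝ) 1) :
    Real.exp (-logConst p) = (∏ i, p i ^ p i) / ∏ i, (1 - p i) ^ (1 - p i) := by
  rw [logConst, Finset.sum_sub_distrib, neg_sub, Real.exp_sub, Real.exp_sum, Real.exp_sum]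
  congr 1
  · exact Finset.prod_congr rfl fun i _ => exp_mul_log_eq_rpow (hp i).1
  · exact Finset.prod_congr rfl fun i _ => exp_mul_log_eq_rpow (by linarith [(hp i).2])

/-- The determinant inequality behind the sharp constant. It is the weighted inequality of
arithmetic and geometric means, the pair `{i, j}` carrying the weight `1 - p k` of the third
index `k`. -/
theorem exp_neg_logConst_mul_le_pairSum {p t : Fin 3 → ℝ} (hp : ∀ i, p i ∈ Set.Icc (0 : ℝ) 1)
    (hsum : p 0 + p 1 + p 2 = 2) (ht : ∀ i, 0 ≤ t i) :
    Real.exp (-logConst p) * ∏ i, t i ^ p i ≤ pairSum p t := by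
  have h0 := (hp 0).1; have h1 := (hp 1).1; have h2 := (hp 2).1
  have q0 : 0 ≤ 1 - p 0 := by linarith [(hp 0).2]
  have q1 : 0 ≤ 1 - p 1 := by linarith [(hp 1).2]
  have q2 : 0 ≤ 1 - p 2 := by linarith [(hp 2).2]
  have t0 := ht 0; have t1 := ht 1; have t2 := ht 2
  have key := Real.geom_mean_le_arith_mean3_weighted q2 q1 q0
    (p₁ := p 0 * p 1 * (t 0 * t 1) / (1 - p 2)) (p₂ := p 0 * p 2 * (t 0 * t 2) / (1 - p 1))
    (p₃ := p 1 * p 2 * (t 1 * t 2) / (1 - p 0)) (by positivity) (by positivity) (by positivity)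
    (by linarith)
  -- equality unless the weight `w` vanishes
  have hle : ∀ w a : ℝ, 0 ≤ a → w * (a / w) ≤ a := fun w a ha => by
    rcases eq_or_ne w 0 with rfl | hw
    · simpa using ha
    · rw [mul_div_cancel₀ _ hw]
  have hsplit : ∀ a b c x : ℝ, 0 ≤ a → 0 ≤ b → c = a + b → 0 ≤ x → x ^ c = x ^ a * x ^ b :=
    fun a b c x ha hb hc hx => by rw [hc, Real.rpow_add_of_nonneg hx ha hb]
  have s0 := fun x hx => hsplit (1 - p 2) (1 - p 1) (p 0) x q2 q1 (by linarith) hx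
  have s1 := fun x hx => hsplit (1 - p 2) (1 - p 0) (p 1) x q2 q0 (by linarith) hx
  have s2 := fun x hx => hsplit (1 - p 1) (1 - p 0) (p 2) x q1 q0 (by linarith) hx
  refine le_trans (le_of_eq ?_) (key.trans (add_le_add (add_le_add (hle _ _ (by positivity))
    (hle _ _ (by positivity))) (hle _ _ (by positivity))))
  rw [exp_neg_logConst hp]
  simp only [Fin.prod_univ_three]
  have hpow : ∀ a b c d w x : ℝ, 0 ≤ a → 0 ≤ b → 0 ≤ c → 0 ≤ d → 0 ≤ w →
      (a * b * (c * d) / w) ^ x = a ^ x * b ^ x * (c ^ x * d ^ x) / w ^ x :=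
    fun a b c d w x ha hb hc hd hw => by
      rw [Real.div_rpow (by positivity) hw, Real.mul_rpow (by positivity) (by positivity),
        Real.mul_rpow ha hb, Real.mul_rpow hc hd]
  rw [hpow _ _ _ _ _ _ h0 h1 t0 t1 q2, hpow _ _ _ _ _ _ h0 h2 t0 t2 q1,
    hpow _ _ _ _ _ _ h1 h2 t1 t2 q0, s0 _ h0, s1 _ h1, s2 _ h2, s0 _ t0, s1 _ t1, s2 _ t2]
  ring

/-- With `a i = p i * c i ^ 2` and `A = ∑ i, a i * v i * (v i)ᵀ`, the bound
`⟨A⁻¹ Θ, Θ⟩ ≤ ∑ i, p i * s i ^ 2` for `Θ = ∑ i, p i * c i * s i * v i`, multiplied by `det A`. -/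
theorem quadForm_le_pairSum_mul {p : Fin 3 → ℝ} (hp : ∀ i, 0 ≤ p i) (c s : Fin 3 → ℝ) :
    (p 1 * c 1 ^ 2 + p 2 * c 2 ^ 2) * (p 0 * c 0 * s 0 + p 2 * c 2 * s 2) ^ 2
      - 2 * (p 2 * c 2 ^ 2) * (p 0 * c 0 * s 0 + p 2 * c 2 * s 2)
        * (p 1 * c 1 * s 1 + p 2 * c 2 * s 2)
      + (p 0 * c 0 ^ 2 + p 2 * c 2 ^ 2) * (p 1 * c 1 * s 1 + p 2 * c 2 * s 2) ^ 2
      ≤ pairSum p (fun i => c i ^ 2) * ∑ i, p i * s i ^ 2 := by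
  have h : 0 ≤ p 0 * p 1 * p 2 * (c 1 * c 2 * s 0 + c 0 * c 2 * s 1 - c 0 * c 1 * s 2) ^ 2 :=
    mul_nonneg (mul_nonneg (mul_nonneg (hp 0) (hp 1)) (hp 2)) (sq_nonneg _)
  rw [pairSum, Fin.sum_univ_three]
  linarith

/-- At least two of three weights in `[0, 1]` with sum `2` are positive. -/
theorem exists_pair_pos {p : Fin 3 → ℝ} (hp : ∀ i, p i ∈ Set.Icc (0 : ℝ) 1)
    (hsum : p 0 + p 1 + p 2 = 2) :
    (0 < p 0 ∧ 0 < p 1) ∨ (0 < p 0 ∧ 0 < p 2) ∨ (0 < p 1 ∧ 0 < p 2) := by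
  have h0 := hp 0; have h1 := hp 1; have h2 := hp 2
  simp only [Set.mem_Icc] at h0 h1 h2
  rcases h0.1.eq_or_lt with h | h
  · exact Or.inr (Or.inr ⟨by linarith, by linarith⟩)
  · rcases h1.1.eq_or_lt with h' | h'
    · exact Or.inr (Or.inl ⟨h, by linarith⟩)
    · exact Or.inl ⟨h, h'⟩

theorem pairSum_pos {p t : Fin 3 → ℝ} (hp : ∀ i, p i ∈ Set.Icc (0 : ℝ) 1)
    (hsum : p 0 + p 1 + p 2 = 2) (ht : ∀ i, 0 < t i) : 0 < pairSum p t := by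
  have h0 := (hp 0).1; have h1 := (hp 1).1; have h2 := (hp 2).1
  have t0 := ht 0; have t1 := ht 1; have t2 := ht 2
  unfold pairSum
  rcases exists_pair_pos hp hsum with ⟨a, b⟩ | ⟨a, b⟩ | ⟨a, b⟩ <;> positivity

/-- Weights in the open cube with the same sum `2`, which converge to `p` as `ε → 0`. -/
noncomputable def perturb (p : Fin 3 → ℝ) (ε : ℝ) (i : Fin 3) : ℝ := (1 - ε) * p i + ε * (2 / 3)

theorem perturb_pos {p : Fin 3 → ℝ} (hp : ∀ i, p i ∈ Set.Icc (0 : ℝ) 1) {ε : ℝ}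
    (hε : ε ∈ Set.Ioo (0 : ℝ) 1) (i : Fin 3) : 0 < perturb p ε i := by
  have := (hp i).1; have h1 := hε.1; have : 0 < 1 - ε := by linarith [hε.2]
  unfold perturb; positivity

theorem perturb_lt_one {p : Fin 3 → ℝ} (hp : ∀ i, p i ∈ Set.Icc (0 : ℝ) 1) {ε : ℝ}
    (hε : ε ∈ Set.Ioo (0 : ℝ) 1) (i : Fin 3) : perturb p ε i < 1 := by
  have := (hp i).2; have h1 := hε.1; have h2 := hε.2
  unfold perturb; nlinarith

theorem perturb_sum {p : Fin 3 → ℝ} (hsum : p 0 + p 1 + p 2 = 2) (ε : ℝ) :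
    perturb p ε 0 + perturb p ε 1 + perturb p ε 2 = 2 := by
  unfold perturb; linear_combination (1 - ε) * hsum

/-- For weights `p` with sum `2` and `n = 1`, twice the value of the Brascamp-Lieb functional at the
centred Gaussian law on `ℝ²` whose covariance consists of the first two rows and columns of
`diag(q) - q qᵀ`, where `q = 1 - r` is a probability vector. -/
noncomputable def crossLog (p r : Fin 3 → ℝ) : ℝ :=
  ∑ i, ((1 - p i) * Real.log (1 - r i) - p i * Real.log (r i))

theorem tendsto_crossLog_perturb (p : Fin 3 → ℝ) :
    Filter.Tendsto (fun ε => crossLog p (perturb p ε)) (nhdsWithin 0 (Set.Ioi 0))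
      (nhds (logConst p)) := by
  refine Filter.Tendsto.mono_left ?_ nhdsWithin_le_nhds
  refine tendsto_finsetSum _ fun i _ => Filter.Tendsto.sub ?_ ?_
  · rcases eq_or_ne (1 - p i) 0 with h | h
    · simp [h]
    · refine Filter.Tendsto.const_mul _ (((Real.continuousAt_log h).tendsto).comp ?_)
      have : Continuous fun ε => 1 - perturb p ε i := by unfold perturb; fun_prop
      simpa [perturb] using this.tendsto 0
  · rcases eq_or_ne (p i) 0 with h | h
    · simp [h]
    · refine Filter.Tendsto.const_mul _ (((Real.continuousAt_log h).tendsto).comp ?_)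
      have : Continuous fun ε => perturb p ε i := by unfold perturb; fun_prop
      simpa [perturb] using this.tendsto 0

/-- Scaling factors at which the bound of the transport argument comes as close to the sharp
constant as desired. The optimal choice `(c i) ^ 2 = 1 / (p i * (1 - p i))` is available in the
open cube only, so the weights are perturbed. -/
theorem exists_scaling {p : Fin 3 → ℝ} (hp : ∀ i, p i ∈ Set.Icc (0 : ℝ) 1)
    (hsum : p 0 + p 1 + p 2 = 2) {K : ℝ} (hK : Real.exp (logConst p / 2) < K) :
    ∃ c : Fin 3 → ℝ, (∀ i, 0 < c i) ∧
      Real.exp (logConst p) * (∏ i, c i ^ p i)⁻¹ * √(pairSum p fun i => c i ^ 2) ≤ K := by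
  have hlim : Filter.Tendsto (fun ε => Real.exp (logConst p - crossLog p (perturb p ε) / 2)
      * (1 - ε)⁻¹) (nhdsWithin 0 (Set.Ioi 0)) (nhds (Real.exp (logConst p / 2))) := by
    have h1 : Filter.Tendsto (fun ε : ℝ => (1 - ε)⁻¹) (nhdsWithin 0 (Set.Ioi 0)) (nhds 1) := by
      have : ContinuousAt (fun ε : ℝ => (1 - ε)⁻¹) 0 :=
        ContinuousAt.inv₀ (by fun_prop) (by norm_num)
      simpa using this.tendsto.mono_left nhdsWithin_le_nhds
    have h2 := ((Real.continuous_exp.tendsto _).comp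
      (((tendsto_crossLog_perturb p).div_const 2).const_sub (logConst p))).mul h1
    simpa [sub_half] using h2
  have hev := (hlim.eventually (gt_mem_nhds hK)).and (Ioo_mem_nhdsGT (zero_lt_one' ℝ))
  obtain ⟨ε, hεK, hε⟩ := hev.exists
  set r := perturb p ε with hr
  have hr0 : ∀ i, 0 < r i := perturb_pos hp hε
  have hr1 : ∀ i, 0 < 1 - r i := fun i => by linarith [perturb_lt_one hp hε i]
  have hrs : r 0 + r 1 + r 2 = 2 := perturb_sum hsum ε
  have hε1 : 0 < 1 - ε := by linarith [hε.2]
  refine ⟨fun i => (√(r i * (1 - r i)))⁻¹, fun i => inv_pos.2 (Real.sqrt_pos.2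
    (mul_pos (hr0 i) (hr1 i))), le_trans ?_ hεK.le⟩
  have hpr : ∀ i, p i ≤ (1 - ε)⁻¹ * r i := fun i => by
    rw [inv_mul_eq_div, le_div_iff₀ hε1, hr, perturb]; nlinarith [hε.1]
  have hsq : ∀ i, (√(r i * (1 - r i)))⁻¹ ^ 2 = (r i * (1 - r i))⁻¹ := fun i => by
    rw [inv_pow, Real.sq_sqrt (mul_pos (hr0 i) (hr1 i)).le]
  have hdet : pairSum p (fun i => (√(r i * (1 - r i)))⁻¹ ^ 2)
      ≤ (1 - ε)⁻¹ ^ 2 * (∏ i, (1 - r i))⁻¹ := by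
    simp only [hsq]
    have hterm : ∀ i j, p i * p j * ((r i * (1 - r i))⁻¹ * (r j * (1 - r j))⁻¹)
        ≤ (1 - ε)⁻¹ ^ 2 * ((1 - r i)⁻¹ * (1 - r j)⁻¹) := fun i j => by
      have hi := hr0 i; have hj := hr0 j; have hi' := hr1 i; have hj' := hr1 j
      calc _ ≤ ((1 - ε)⁻¹ * r i) * ((1 - ε)⁻¹ * r j)
            * ((r i * (1 - r i))⁻¹ * (r j * (1 - r j))⁻¹) := by
            have := (hp j).1
            gcongr
            · exact hpr i
            · exact hpr j
        _ = _ := by field_simp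
    refine (add_le_add (add_le_add (hterm 0 1) (hterm 0 2)) (hterm 1 2)).trans (le_of_eq ?_)
    have a0 := (hr1 0).ne'; have a1 := (hr1 1).ne'; have a2 := (hr1 2).ne'
    rw [Fin.prod_univ_three]
    field_simp
    linarith
  have hlog : ∀ i, 0 < r i * (1 - r i) := fun i => mul_pos (hr0 i) (hr1 i)
  have hprod : (∏ i, ((√(r i * (1 - r i)))⁻¹) ^ p i)⁻¹
      = Real.exp (∑ i, p i * (Real.log (r i) + Real.log (1 - r i)) / 2) := by
    rw [← Finset.prod_inv_distrib, Real.exp_sum]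
    refine Finset.prod_congr rfl fun i _ => ?_
    rw [← Real.inv_rpow (by positivity), inv_inv, Real.rpow_def_of_pos (Real.sqrt_pos.2 (hlog i)),
      Real.log_sqrt (hlog i).le, Real.log_mul (hr0 i).ne' (hr1 i).ne']
    congr 1; ring
  have hsqrt : √(pairSum p fun i => (√(r i * (1 - r i)))⁻¹ ^ 2)
      ≤ (1 - ε)⁻¹ * Real.exp (- ∑ i, Real.log (1 - r i) / 2) := by
    refine (Real.sqrt_le_sqrt hdet).trans (le_of_eq ?_)
    rw [Real.sqrt_mul (by positivity), Real.sqrt_sq (by positivity), Real.sqrt_inv, Real.exp_neg,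
      Real.exp_sum, Real.sqrt_prod _ fun i _ => (hr1 i).le]
    congr 2
    refine Finset.prod_congr rfl fun i _ => ?_
    rw [Real.exp_half, Real.exp_log (hr1 i)]
  calc _ ≤ Real.exp (logConst p) * Real.exp (∑ i, p i * (Real.log (r i) + Real.log (1 - r i)) / 2)
        * ((1 - ε)⁻¹ * Real.exp (- ∑ i, Real.log (1 - r i) / 2)) := by
        rw [hprod]; gcongr
    _ = _ := by
        rw [mul_left_comm, ← Real.exp_add, ← Real.exp_add, mul_comm]
        congr 2
        rw [crossLog]
        simp only [Fin.sum_univ_three]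
        ring

/-! ### Transport to the Gaussian law on the line -/

theorem hasDerivAt_cdf_gaussianReal (x : ℝ) :
    HasDerivAt (ProbabilityTheory.cdf (ProbabilityTheory.gaussianReal 0 1))
      (ProbabilityTheory.gaussianPDFReal 0 1 x) x := by
  have hint := ProbabilityTheory.integrable_gaussianPDFReal 0 1
  have hcont : Continuous (ProbabilityTheory.gaussianPDFReal 0 1) := by
    unfold ProbabilityTheory.gaussianPDFReal; fun_prop
  have heq : ∀ y, ProbabilityTheory.cdf (ProbabilityTheory.gaussianReal 0 1) y
      = ∫ t in Set.Iic y, ProbabilityTheory.gaussianPDFReal 0 1 t := fun y => by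
    rw [ProbabilityTheory.cdf_eq_real, measureReal_def,
      ProbabilityTheory.gaussianReal_apply_eq_integral 0 one_ne_zero, ENNReal.toReal_ofReal]
    exact integral_nonneg fun t => ProbabilityTheory.gaussianPDFReal_nonneg 0 1 t
  have hd : HasDerivAt (fun y => (∫ t in (0 : ℝ)..y, ProbabilityTheory.gaussianPDFReal 0 1 t)
      + ∫ t in Set.Iic 0, ProbabilityTheory.gaussianPDFReal 0 1 t)
      (ProbabilityTheory.gaussianPDFReal 0 1 x) x :=
    (intervalIntegral.integral_hasDerivAt_right (hcont.intervalIntegrable _ _)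
      (hcont.stronglyMeasurableAtFilter _ _) hcont.continuousAt).add_const _
  refine hd.congr_of_eventuallyEq (Filter.Eventually.of_forall fun y => ?_)
  simp only [heq, ← intervalIntegral.integral_Iic_sub_Iic hint.integrableOn hint.integrableOn,
    sub_add_cancel]

/-- The standard Gaussian distribution function is invertible on `(0, 1)`, with a
differentiable inverse. -/
theorem exists_gaussian_quantile : ∃ Ψ : ℝ → ℝ, StrictMonoOn Ψ (Set.Ioo 0 1) ∧
    ∀ y ∈ Set.Ioo (0 : ℝ) 1,
      HasDerivAt Ψ (ProbabilityTheory.gaussianPDFReal 0 1 (Ψ y))⁻¹ y := by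
  set Φ : ℝ → ℝ := ⇑(ProbabilityTheory.cdf (ProbabilityTheory.gaussianReal 0 1)) with hΦ
  have hpos := fun x => ProbabilityTheory.gaussianPDFReal_pos 0 1 x one_ne_zero
  have hmono : StrictMono Φ := strictMono_of_hasDerivAt_pos hasDerivAt_cdf_gaussianReal hpos
  have hcont : Continuous Φ :=
    continuous_iff_continuousAt.2 fun x => (hasDerivAt_cdf_gaussianReal x).continuousAt
  have hmem : ∀ x, Φ x ∈ Set.Ioo (0 : ℝ) 1 := fun x =>
    ⟨(ProbabilityTheory.cdf_nonneg _ (x - 1)).trans_lt (hmono (by linarith)),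
      (hmono (by linarith : x < x + 1)).trans_le (ProbabilityTheory.cdf_le_one _ _)⟩
  have hsurj : ∀ y ∈ Set.Ioo (0 : ℝ) 1, ∃ x, Φ x = y := fun y hy => by
    obtain ⟨a, ha⟩ := ((ProbabilityTheory.tendsto_cdf_atBot
      (ProbabilityTheory.gaussianReal 0 1)).eventually (gt_mem_nhds hy.1)).exists
    obtain ⟨b, hb⟩ := ((ProbabilityTheory.tendsto_cdf_atTop
      (ProbabilityTheory.gaussianReal 0 1)).eventually (lt_mem_nhds hy.2)).exists
    exact mem_range_of_exists_le_of_exists_ge hcont ⟨a, ha.le⟩ ⟨b, hb.le⟩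
  have hinv : ∀ y ∈ Set.Ioo (0 : ℝ) 1, Φ (Function.invFun Φ y) = y := fun y hy =>
    Function.invFun_eq (hsurj y hy)
  have hΨ : StrictMonoOn (Function.invFun Φ) (Set.Ioo 0 1) := fun y hy z hz hyz =>
    hmono.lt_iff_lt.1 (by rwa [hinv y hy, hinv z hz])
  refine ⟨Function.invFun Φ, hΨ, fun y hy => ?_⟩
  have himg : Function.invFun Φ '' Set.Ioo 0 1 = Set.univ := Set.eq_univ_of_forall fun x =>
    ⟨Φ x, hmem x, Function.leftInverse_invFun hmono.injective x⟩
  refine HasDerivAt.of_local_left_inverse (f := Φ) ?_ (hasDerivAt_cdf_gaussianReal _)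
    (hpos _).ne' ?_
  · exact hΨ.continuousAt_of_image_mem_nhds (Ioo_mem_nhds hy.1 hy.2)
      (by rw [himg]; exact Filter.univ_mem)
  · exact Filter.eventually_of_mem (Ioo_mem_nhds hy.1 hy.2) hinv

/-- The monotone transport `T` of a probability density `u` on the line to the standard Gaussian
density. The Monge-Ampère equation holds on a measurable set `G` that carries `u`. No regularity
of `u` is needed, as its distribution function is differentiable almost everywhere. -/
theorem exists_gaussian_transport {u : ℝ → ℝ≥0∞} (hu : Measurable u) (h1 : ∫⁻ x, u x = 1) :
    ∃ (T : ℝ → ℝ) (G : Set ℝ), MeasurableSet G ∧ (∀ᵐ x, x ∉ G → u x = 0) ∧ StrictMonoOn T G ∧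
      ∀ x ∈ G, ∃ d, 0 < d ∧ HasDerivAt T d x ∧
        u x = ENNReal.ofReal (ProbabilityTheory.gaussianPDFReal 0 1 (T x) * d) := by
  obtain ⟨Ψ, hΨm, hΨd⟩ := exists_gaussian_quantile
  set μ : Measure ℝ := volume.withDensity u with hμ
  have : IsProbabilityMeasure μ := ⟨by rw [hμ, withDensity_apply _ MeasurableSet.univ]; simpa⟩
  set F := ProbabilityTheory.cdf μ with hF
  have hder : ∀ᵐ x, HasDerivAt F (u x).toReal x := by
    filter_upwards [F.ae_hasDerivAt, Measure.rnDeriv_withDensity volume hu] with x hx hx'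
    rwa [hF, ProbabilityTheory.measure_cdf, hx'] at hx
  have htop : ∀ᵐ x, u x < ∞ := ae_lt_top hu (by rw [h1]; exact ENNReal.one_ne_top)
  obtain ⟨N, hN, hNm, hN0⟩ := exists_measurable_superset_of_null (ae_iff.1 (hder.and htop))
  have hgood : ∀ x ∉ N, HasDerivAt F (u x).toReal x ∧ u x < ∞ := fun x hx => by
    by_contra h; exact hx (hN h)
  set G : Set ℝ := Nᶜ ∩ {x | u x ≠ 0} with hG
  have hFpos : ∀ x ∈ G, 0 < (u x).toReal := fun x hx =>
    ENNReal.toReal_pos hx.2 (hgood x hx.1).2.ne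
  -- a positive derivative makes the monotone `F` strictly increase through the point
  have hlt : ∀ x ∈ G, ∀ y, x < y → F x < F y := fun x hx y hxy => by
    refine (F.mono hxy.le).lt_of_ne fun heq => (hFpos x hx).ne' ?_
    have hconst : ∀ᶠ z in nhdsWithin x (Set.Ioi x), F z = F x := by
      filter_upwards [Ioo_mem_nhdsGT hxy] with z hz
      exact le_antisymm (heq ▸ F.mono hz.2.le) (F.mono hz.1.le)
    have h0 : HasDerivWithinAt F 0 (Set.Ioi x) x :=
      (hasDerivWithinAt_const x (Set.Ioi x) (F x)).congr_of_eventuallyEq hconst rfl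
    exact (uniqueDiffWithinAt_Ioi x).eq_deriv _ (hgood x hx.1).1.hasDerivWithinAt h0
  have hlt' : ∀ x ∈ G, ∀ y, y < x → F y < F x := fun x hx y hxy => by
    refine (F.mono hxy.le).lt_of_ne fun heq => (hFpos x hx).ne' ?_
    have hconst : ∀ᶠ z in nhdsWithin x (Set.Iio x), F z = F x := by
      filter_upwards [Ioo_mem_nhdsLT hxy] with z hz
      exact le_antisymm (F.mono hz.2.le) (heq ▸ F.mono hz.1.le)
    have h0 : HasDerivWithinAt F 0 (Set.Iio x) x :=
      (hasDerivWithinAt_const x (Set.Iio x) (F x)).congr_of_eventuallyEq hconst rfl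
    exact (uniqueDiffWithinAt_Iio x).eq_deriv _ (hgood x hx.1).1.hasDerivWithinAt h0
  have hF01 : ∀ x ∈ G, F x ∈ Set.Ioo (0 : ℝ) 1 := fun x hx =>
    ⟨(ProbabilityTheory.cdf_nonneg μ (x - 1)).trans_lt (hlt' x hx _ (by linarith)),
      (hlt x hx (x + 1) (by linarith)).trans_le (ProbabilityTheory.cdf_le_one μ _)⟩
  refine ⟨Ψ ∘ F, G, hNm.compl.inter (hu (measurableSet_singleton 0).compl), ?_, ?_, ?_⟩
  · filter_upwards [compl_mem_ae_iff.2 hN0] with x hx hxG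
    by_contra h
    exact hxG ⟨hx, h⟩
  · exact fun x hx y hy hxy => hΨm (hF01 x hx) (hF01 y hy) (hlt x hx y hxy)
  · intro x hx
    have hpdf := ProbabilityTheory.gaussianPDFReal_pos 0 1 (Ψ (F x)) one_ne_zero
    refine ⟨_, mul_pos (inv_pos.2 hpdf) (hFpos x hx),
      (hΨd _ (hF01 x hx)).comp x (hgood x hx.1).1, ?_⟩
    rw [Function.comp_apply, mul_inv_cancel_left₀ hpdf.ne',
      ENNReal.ofReal_toReal (hgood x hx.1).2.ne]

/-! ### The sharp Young inequality on the line -/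

/-- The three linear maps `x`, `y`, `x + y` of the standard datum. -/
def form {E : Type*} [Add E] (i : Fin 3) (x y : E) : E := ![x, y, x + y] i

theorem lintegral_exp_neg_mul_sub_sq {b : ℝ} (hb : 0 < b) (s : ℝ) :
    ∫⁻ x : ℝ, ENNReal.ofReal (Real.exp (-b * (x - s) ^ 2)) = ENNReal.ofReal √(Real.pi / b) := by
  rw [lintegral_sub_right_eq_self (fun x => ENNReal.ofReal (Real.exp (-b * x ^ 2))) s,
    ← ofReal_integral_eq_lintegral_ofReal (integrable_exp_neg_mul_sq hb)
      (Filter.Eventually.of_forall fun x => (Real.exp_pos _).le), integral_gaussian]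

/-- The planar Gaussian integral with covariance matrix of entries `α`, `β`, `β`, `γ`. -/
theorem lintegral_gaussian_plane {α β γ : ℝ} (hα : 0 < α) (hD : 0 < α * γ - β ^ 2) :
    ∫⁻ z : ℝ × ℝ, ENNReal.ofReal ((2 * Real.pi)⁻¹ * Real.exp
      (-(γ * z.1 ^ 2 - 2 * β * z.1 * z.2 + α * z.2 ^ 2) / (2 * (α * γ - β ^ 2))))
      = ENNReal.ofReal √(α * γ - β ^ 2) := by
  set D := α * γ - β ^ 2 with hDdef
  have hsq : ∀ x y : ℝ, (2 * Real.pi)⁻¹ * Real.exp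
      (-(γ * x ^ 2 - 2 * β * x * y + α * y ^ 2) / (2 * D))
      = (2 * Real.pi)⁻¹ * Real.exp (-(1 / (2 * α)) * (x - 0) ^ 2)
        * Real.exp (-(α / (2 * D)) * (y - β * x / α) ^ 2) := fun x y => by
    rw [mul_assoc (2 * Real.pi)⁻¹ (Real.exp _), ← Real.exp_add]
    congr 2
    field_simp
    rw [hDdef]
    ring
  rw [Measure.volume_eq_prod, lintegral_prod _ (by fun_prop)]
  simp only [hsq]
  have hpos : ∀ x : ℝ, 0 ≤ (2 * Real.pi)⁻¹ * Real.exp (-(1 / (2 * α)) * (x - 0) ^ 2) :=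
    fun x => by positivity
  simp only [ENNReal.ofReal_mul (hpos _)]
  have hinner : ∀ x : ℝ, ∫⁻ y : ℝ, ENNReal.ofReal
      ((2 * Real.pi)⁻¹ * Real.exp (-(1 / (2 * α)) * (x - 0) ^ 2))
        * ENNReal.ofReal (Real.exp (-(α / (2 * D)) * (y - β * x / α) ^ 2))
      = ENNReal.ofReal ((2 * Real.pi)⁻¹ * Real.exp (-(1 / (2 * α)) * (x - 0) ^ 2))
        * ENNReal.ofReal √(Real.pi / (α / (2 * D))) := fun x => by
    rw [lintegral_const_mul _ (by fun_prop), lintegral_exp_neg_mul_sub_sq (by positivity)]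
  simp only [hinner]
  rw [lintegral_mul_const _ (by fun_prop)]
  simp only [ENNReal.ofReal_mul (by positivity : (0 : ℝ) ≤ (2 * Real.pi)⁻¹)]
  rw [lintegral_const_mul _ (by fun_prop), lintegral_exp_neg_mul_sub_sq (by positivity),
    ← ENNReal.ofReal_mul (by positivity), ← ENNReal.ofReal_mul (by positivity)]
  congr 1
  rw [mul_assoc, ← Real.sqrt_mul (by positivity), inv_mul_eq_iff_eq_mul₀ (by positivity)]
  have h2 : Real.pi / (1 / (2 * α)) * (Real.pi / (α / (2 * D))) = (2 * Real.pi) ^ 2 * D := by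
    field_simp
  rw [h2, Real.sqrt_mul (by positivity), Real.sqrt_sq (by positivity)]

/-- The change of variables `z ↦ ∑ i, p i * c i * T i ⟨z, v i⟩ • v i` of the transport argument,
where `v 0 = (1, 0)`, `v 1 = (0, 1)` and `v 2 = (1, 1)`. -/
noncomputable def transportMap (p c : Fin 3 → ℝ) (T : Fin 3 → ℝ → ℝ) (z : ℝ × ℝ) : ℝ × ℝ :=
  (p 0 * c 0 * T 0 z.1 + p 2 * c 2 * T 2 (z.1 + z.2),
    p 1 * c 1 * T 1 z.2 + p 2 * c 2 * T 2 (z.1 + z.2))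

/-- The derivative of `transportMap p c T` at a point where `T i` has derivative `d i`. -/
noncomputable def transportDeriv (p c d : Fin 3 → ℝ) : ℝ × ℝ →L[ℝ] ℝ × ℝ :=
  LinearMap.toContinuousLinearMap (Matrix.toLin (Module.Basis.finTwoProd ℝ)
    (Module.Basis.finTwoProd ℝ) !![p 0 * c 0 * d 0 + p 2 * c 2 * d 2, p 2 * c 2 * d 2;
      p 2 * c 2 * d 2, p 1 * c 1 * d 1 + p 2 * c 2 * d 2])

theorem det_transportDeriv (p c d : Fin 3 → ℝ) :
    (transportDeriv p c d).det = pairSum p (fun i => c i * d i) := by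
  rw [transportDeriv, LinearMap.det_toContinuousLinearMap, LinearMap.det_toLin,
    Matrix.det_fin_two_of, pairSum]
  ring

theorem hasFDerivAt_transportMap (p c : Fin 3 → ℝ) {T : Fin 3 → ℝ → ℝ} {d : Fin 3 → ℝ} {z : ℝ × ℝ}
    (h : ∀ i, HasDerivAt (T i) (d i) (form i z.1 z.2)) :
    HasFDerivAt (transportMap p c T) (transportDeriv p c d) z := by
  have h0 : HasFDerivAt (fun z : ℝ × ℝ => T 0 z.1) (d 0 • ContinuousLinearMap.fst ℝ ℝ ℝ) z :=
    HasDerivAt.comp_hasFDerivAt z (h 0) hasFDerivAt_fst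
  have h1 : HasFDerivAt (fun z : ℝ × ℝ => T 1 z.2) (d 1 • ContinuousLinearMap.snd ℝ ℝ ℝ) z :=
    HasDerivAt.comp_hasFDerivAt z (h 1) hasFDerivAt_snd
  have h2 : HasFDerivAt (fun z : ℝ × ℝ => T 2 (z.1 + z.2))
      (d 2 • (ContinuousLinearMap.fst ℝ ℝ ℝ + ContinuousLinearMap.snd ℝ ℝ ℝ)) z :=
    HasDerivAt.comp_hasFDerivAt z (h 2) (hasFDerivAt_fst.add hasFDerivAt_snd)
  have h3 := ((h0.const_mul (p 0 * c 0)).add (h2.const_mul (p 2 * c 2))).prodMk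
    ((h1.const_mul (p 1 * c 1)).add (h2.const_mul (p 2 * c 2)))
  refine h3.congr_fderiv ?_
  rw [transportDeriv, Matrix.toLin_finTwoProd_toContinuousLinearMap]
  ext <;> simp

/-- The transport map is strictly monotone, hence injective. -/
theorem injOn_transportMap {p c : Fin 3 → ℝ} (hp : ∀ i, p i ∈ Set.Icc (0 : ℝ) 1)
    (hsum : p 0 + p 1 + p 2 = 2) (hc : ∀ i, 0 < c i) {T : Fin 3 → ℝ → ℝ} {G : Fin 3 → Set ℝ}
    (hT : ∀ i, StrictMonoOn (T i) (G i)) :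
    Set.InjOn (transportMap p c T) {z | ∀ i, form i z.1 z.2 ∈ G i} := by
  rintro ⟨x, y⟩ hz ⟨x', y'⟩ hz' heq
  have hmon : ∀ i, 0 ≤ (T i (form i x y) - T i (form i x' y')) * (form i x y - form i x' y') ∧
      ((T i (form i x y) - T i (form i x' y')) * (form i x y - form i x' y') = 0 →
        form i x y = form i x' y') := fun i => by
    rcases lt_trichotomy (form i x y) (form i x' y') with h | h | h
    · have := hT i (hz i) (hz' i) h
      have := mul_pos_of_neg_of_neg (sub_neg.2 this) (sub_neg.2 h)
      exact ⟨this.le, fun h0 => absurd h0 this.ne'⟩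
    · exact ⟨by simp [h], fun _ => h⟩
    · have := hT i (hz' i) (hz i) h
      have := mul_pos (sub_pos.2 this) (sub_pos.2 h)
      exact ⟨this.le, fun h0 => absurd h0 this.ne'⟩
  have e1 := congrArg Prod.fst heq
  have e2 := congrArg Prod.snd heq
  simp only [transportMap] at e1 e2
  have m0 := hmon 0; have m1 := hmon 1; have m2 := hmon 2
  simp only [form, Matrix.cons_val] at m0 m1 m2
  have k0 := mul_nonneg (mul_nonneg (hp 0).1 (hc 0).le) m0.1
  have k1 := mul_nonneg (mul_nonneg (hp 1).1 (hc 1).le) m1.1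
  have k2 := mul_nonneg (mul_nonneg (hp 2).1 (hc 2).le) m2.1
  have hs : p 0 * c 0 * ((T 0 x - T 0 x') * (x - x')) + p 1 * c 1 * ((T 1 y - T 1 y') * (y - y'))
      + p 2 * c 2 * ((T 2 (x + y) - T 2 (x' + y')) * (x + y - (x' + y'))) = 0 := by
    linear_combination (x - x') * e1 + (y - y') * e2
  have c0 : 0 < p 0 → x = x' := fun h => m0.2 <|
    (mul_eq_zero.1 (by linarith : p 0 * c 0 * _ = 0)).resolve_left (mul_pos h (hc 0)).ne'
  have c1 : 0 < p 1 → y = y' := fun h => m1.2 <|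
    (mul_eq_zero.1 (by linarith : p 1 * c 1 * _ = 0)).resolve_left (mul_pos h (hc 1)).ne'
  have c2 : 0 < p 2 → x + y = x' + y' := fun h => m2.2 <|
    (mul_eq_zero.1 (by linarith : p 2 * c 2 * _ = 0)).resolve_left (mul_pos h (hc 2)).ne'
  rcases exists_pair_pos hp hsum with ⟨a, b⟩ | ⟨a, b⟩ | ⟨a, b⟩
  · rw [c0 a, c1 b]
  · obtain rfl := c0 a; rw [add_left_cancel (c2 b)]
  · obtain rfl := c1 a; rw [add_right_cancel (c2 b)]

/-- The pointwise bound of the transport argument: the product of the densities is at most a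
constant times the Jacobian of the transport map times a Gaussian density at the image point. -/
theorem prod_rpow_le_jacobian {p c d : Fin 3 → ℝ} (hp : ∀ i, p i ∈ Set.Icc (0 : ℝ) 1)
    (hsum : p 0 + p 1 + p 2 = 2) (hc : ∀ i, 0 < c i) (hd : ∀ i, 0 < d i) (s : Fin 3 → ℝ)
    {X Y : ℝ} (hX : X = p 0 * c 0 * s 0 + p 2 * c 2 * s 2)
    (hY : Y = p 1 * c 1 * s 1 + p 2 * c 2 * s 2) :
    ∏ i, (ProbabilityTheory.gaussianPDFReal 0 1 (s i) * d i) ^ p i ≤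
      Real.exp (logConst p) * (∏ i, c i ^ p i)⁻¹ * (pairSum p (fun i => c i * d i) *
        ((2 * Real.pi)⁻¹ * Real.exp (-((p 1 * c 1 ^ 2 + p 2 * c 2 ^ 2) * X ^ 2
          - 2 * (p 2 * c 2 ^ 2) * X * Y + (p 0 * c 0 ^ 2 + p 2 * c 2 ^ 2) * Y ^ 2)
          / (2 * pairSum p (fun i => c i ^ 2))))) := by
  have hdet : 0 < pairSum p (fun i => c i ^ 2) := pairSum_pos hp hsum fun i => pow_pos (hc i) 2
  have hgauss : ∏ i, ProbabilityTheory.gaussianPDFReal 0 1 (s i) ^ p i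
      = (2 * Real.pi)⁻¹ * Real.exp (-(∑ i, p i * s i ^ 2) / 2) := by
    have hφ : ∀ i, ProbabilityTheory.gaussianPDFReal 0 1 (s i) ^ p i
        = Real.exp (-(p i * Real.log (2 * Real.pi)) / 2 - p i * s i ^ 2 / 2) := fun i => by
      rw [Real.rpow_def_of_pos (ProbabilityTheory.gaussianPDFReal_pos 0 1 _ one_ne_zero),
        ProbabilityTheory.gaussianPDFReal, Real.log_mul (by positivity) (by positivity),
        Real.log_exp, Real.log_inv, Real.log_sqrt (by positivity)]
      congr 1
      simp
      ring
    rw [Finset.prod_congr rfl fun i _ => hφ i, ← Real.exp_sum]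
    have : (2 * Real.pi)⁻¹ = Real.exp (-Real.log (2 * Real.pi)) := by
      rw [Real.exp_neg, Real.exp_log (by positivity)]
    rw [this, ← Real.exp_add]
    congr 1
    simp only [Fin.sum_univ_three]
    linear_combination (-Real.log (2 * Real.pi) / 2) * hsum
  have hamgm := exp_neg_logConst_mul_le_pairSum hp hsum (t := fun i => c i * d i)
    fun i => (mul_pos (hc i) (hd i)).le
  have hquad := quadForm_le_pairSum_mul (fun i => (hp i).1) c s
  rw [Real.exp_neg, inv_mul_le_iff₀ (Real.exp_pos _)] at hamgm
  simp only [Real.mul_rpow (hc _).le (hd _).le, Finset.prod_mul_distrib] at hamgm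
  have hC : 0 < ∏ i, c i ^ p i := Finset.prod_pos fun i _ => Real.rpow_pos_of_pos (hc i) _
  have hexp : Real.exp (-(∑ i, p i * s i ^ 2) / 2)
      ≤ Real.exp (-((p 1 * c 1 ^ 2 + p 2 * c 2 ^ 2) * X ^ 2
          - 2 * (p 2 * c 2 ^ 2) * X * Y + (p 0 * c 0 ^ 2 + p 2 * c 2 ^ 2) * Y ^ 2)
          / (2 * pairSum p (fun i => c i ^ 2))) := by
    rw [hX, hY, Real.exp_le_exp, neg_div, neg_div, neg_le_neg_iff, div_le_div_iff₀ (by positivity)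
      two_pos]
    linarith
  rw [Finset.prod_congr rfl fun i _ => Real.mul_rpow
    (ProbabilityTheory.gaussianPDFReal_nonneg 0 1 (s i)) (hd i).le, Finset.prod_mul_distrib, hgauss]
  have hd' : ∏ i, d i ^ p i ≤ Real.exp (logConst p) * (∏ i, c i ^ p i)⁻¹ *
      pairSum p (fun i => c i * d i) := by
    rw [mul_right_comm, ← div_eq_mul_inv, le_div_iff₀ hC]
    linarith
  calc _ ≤ (2 * Real.pi)⁻¹ * Real.exp _ * (Real.exp (logConst p) * (∏ i, c i ^ p i)⁻¹ *
      pairSum p (fun i => c i * d i)) := by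
        refine mul_le_mul (mul_le_mul_of_nonneg_left hexp (by positivity)) hd' ?_ (by positivity)
        exact Finset.prod_nonneg fun i _ => Real.rpow_nonneg (hd i).le _
    _ = _ := by ring

theorem measurable_form {E : Type*} [Add E] [MeasurableSpace E] [MeasurableAdd₂ E] (i : Fin 3) :
    Measurable fun z : E × E => form i z.1 z.2 := by
  fin_cases i
  · exact measurable_fst
  · exact measurable_snd
  · exact measurable_fst.add measurable_snd

theorem quasiMeasurePreserving_form (i : Fin 3) :
    Measure.QuasiMeasurePreserving (fun z : ℝ × ℝ => form i z.1 z.2) volume volume := by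
  fin_cases i
  · exact Measure.quasiMeasurePreserving_fst
  · exact Measure.quasiMeasurePreserving_snd
  · exact quasiMeasurePreserving_add volume volume

theorem measurable_prod_form {E : Type*} [Add E] [MeasurableSpace E] [MeasurableAdd₂ E]
    (p : Fin 3 → ℝ) {u : Fin 3 → E → ℝ≥0∞} (hu : ∀ i, Measurable (u i)) :
    Measurable fun z : E × E => ∏ i, u i (form i z.1 z.2) ^ p i :=
  Finset.measurable_prod _ fun i _ => ((hu i).comp (measurable_form i)).pow_const _

/-- The transport bound for probability densities, for arbitrary scaling factors `c`. A density
that enters with exponent `0` is assumed to vanish nowhere, so that the integrand is zero wherever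
one of the transports is not defined. -/
theorem lintegral_prod_rpow_le_of_scaling {p : Fin 3 → ℝ} (hp : ∀ i, p i ∈ Set.Icc (0 : ℝ) 1)
    (hsum : p 0 + p 1 + p 2 = 2) {u : Fin 3 → ℝ → ℝ≥0∞} (hu : ∀ i, Measurable (u i))
    (h1 : ∀ i, ∫⁻ x, u i x = 1) (hzero : ∀ i, p i = 0 → ∀ x, u i x ≠ 0) {c : Fin 3 → ℝ}
    (hc : ∀ i, 0 < c i) :
    ∫⁻ z : ℝ × ℝ, ∏ i, u i (form i z.1 z.2) ^ p i ≤ ENNReal.ofReal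
      (Real.exp (logConst p) * (∏ i, c i ^ p i)⁻¹ * √(pairSum p fun i => c i ^ 2)) := by
  choose T G hG hGu hT hMA using fun i => exists_gaussian_transport (hu i) (h1 i)
  choose! d hd hder heq using hMA
  set S : Set (ℝ × ℝ) := {z | ∀ i, form i z.1 z.2 ∈ G i} with hS
  have hSm : MeasurableSet S := by
    rw [hS, Set.ofPred_forall]
    exact MeasurableSet.iInter fun i => measurable_form i (hG i)
  have hae : ∀ᵐ z : ℝ × ℝ, ∀ i, form i z.1 z.2 ∉ G i → u i (form i z.1 z.2) = 0 :=
    ae_all_iff.2 fun i => (quasiMeasurePreserving_form i).ae (hGu i)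
  have hoff : ∀ᵐ z : ℝ × ℝ, z ∉ S → ∏ i, u i (form i z.1 z.2) ^ p i = 0 := by
    filter_upwards [hae] with z hz hzS
    simp only [hS, Set.mem_ofPred_eq, not_forall] at hzS
    obtain ⟨i, hi⟩ := hzS
    refine Finset.prod_eq_zero (Finset.mem_univ i) ?_
    have hpi : p i ≠ 0 := fun h => hzero i h _ (hz i hi)
    rw [hz i hi, ENNReal.zero_rpow_of_pos ((hp i).1.lt_of_ne' hpi)]
  set K := Real.exp (logConst p) * (∏ i, c i ^ p i)⁻¹ with hK
  have hK0 : 0 ≤ K := mul_nonneg (Real.exp_pos _).le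
    (inv_nonneg.2 (Finset.prod_nonneg fun i _ => Real.rpow_nonneg (hc i).le _))
  set g : ℝ × ℝ → ℝ≥0∞ := fun w => ENNReal.ofReal ((2 * Real.pi)⁻¹ * Real.exp
    (-((p 1 * c 1 ^ 2 + p 2 * c 2 ^ 2) * w.1 ^ 2 - 2 * (p 2 * c 2 ^ 2) * w.1 * w.2
      + (p 0 * c 0 ^ 2 + p 2 * c 2 ^ 2) * w.2 ^ 2) / (2 * pairSum p (fun i => c i ^ 2)))) with hg
  have hpt : ∀ z ∈ S, ∏ i, u i (form i z.1 z.2) ^ p i ≤ ENNReal.ofReal K *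
      (ENNReal.ofReal |(transportDeriv p c fun i => d i (form i z.1 z.2)).det|
        * g (transportMap p c T z)) := fun z hz => by
    have hdz : ∀ i, 0 < d i (form i z.1 z.2) := fun i => hd i _ (hz i)
    have hpair := pairSum_pos hp hsum fun i => mul_pos (hc i) (hdz i)
    have hb := prod_rpow_le_jacobian hp hsum hc hdz (fun i => T i (form i z.1 z.2))
      (X := (transportMap p c T z).1) (Y := (transportMap p c T z).2) rfl rfl
    rw [det_transportDeriv, abs_of_pos hpair, hg, ← ENNReal.ofReal_mul hpair.le,
      ← ENNReal.ofReal_mul hK0]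
    refine le_trans (le_of_eq ?_) (ENNReal.ofReal_le_ofReal hb)
    have hnn : ∀ i, 0 ≤ ProbabilityTheory.gaussianPDFReal 0 1 (T i (form i z.1 z.2))
        * d i (form i z.1 z.2) := fun i =>
      mul_nonneg (ProbabilityTheory.gaussianPDFReal_nonneg 0 1 _) (hdz i).le
    rw [ENNReal.ofReal_prod_of_nonneg fun i _ => Real.rpow_nonneg (hnn i) _]
    refine Finset.prod_congr rfl fun i _ => ?_
    rw [heq i _ (hz i), ENNReal.ofReal_rpow_of_nonneg (hnn i) (hp i).1]
  have hα : 0 < p 0 * c 0 ^ 2 + p 2 * c 2 ^ 2 := by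
    have a0 := (hp 0).1; have a2 := (hp 2).1; have b0 := hc 0; have b2 := hc 2
    rcases exists_pair_pos hp hsum with ⟨a, b⟩ | ⟨a, b⟩ | ⟨a, b⟩ <;> positivity
  have hdet : pairSum p (fun i => c i ^ 2) = (p 0 * c 0 ^ 2 + p 2 * c 2 ^ 2)
      * (p 1 * c 1 ^ 2 + p 2 * c 2 ^ 2) - (p 2 * c 2 ^ 2) ^ 2 := by
    rw [pairSum]; ring
  have hint : ∫⁻ w, g w = ENNReal.ofReal √(pairSum p fun i => c i ^ 2) := by
    have hpos := pairSum_pos hp hsum fun i => pow_pos (hc i) 2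
    rw [hdet] at hpos
    rw [hg, hdet]
    exact lintegral_gaussian_plane hα hpos
  calc ∫⁻ z : ℝ × ℝ, ∏ i, u i (form i z.1 z.2) ^ p i
      = ∫⁻ z in S, ∏ i, u i (form i z.1 z.2) ^ p i := by
        rw [← lintegral_indicator hSm]
        refine lintegral_congr_ae ?_
        filter_upwards [hoff] with z hz
        by_cases h : z ∈ S
        · rw [Set.indicator_of_mem h]
        · rw [Set.indicator_of_notMem h, hz h]
    _ ≤ ∫⁻ z in S, ENNReal.ofReal K *
      (ENNReal.ofReal |(transportDeriv p c fun i => d i (form i z.1 z.2)).det|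
        * g (transportMap p c T z)) := setLIntegral_mono' hSm hpt
    _ = ENNReal.ofReal K * ∫⁻ w in transportMap p c T '' S, g w := by
        rw [lintegral_const_mul' _ _ ENNReal.ofReal_ne_top,
          lintegral_image_eq_lintegral_abs_det_fderiv_mul volume hSm
            (fun z hz => (hasFDerivAt_transportMap p c
              fun i => hder i _ (hz i)).hasFDerivWithinAt)
            (injOn_transportMap hp hsum hc hT)]
    _ ≤ ENNReal.ofReal K * ∫⁻ w, g w := by gcongr; exact Measure.restrict_le_self
    _ = _ := by rw [hint, ENNReal.ofReal_mul hK0]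

theorem lintegral_prod_rpow_le_of_lintegral_eq_one {p : Fin 3 → ℝ}
    (hp : ∀ i, p i ∈ Set.Icc (0 : ℝ) 1) (hsum : p 0 + p 1 + p 2 = 2) {u : Fin 3 → ℝ → ℝ≥0∞}
    (hu : ∀ i, Measurable (u i)) (h1 : ∀ i, p i ≠ 0 → ∫⁻ x, u i x = 1) :
    ∫⁻ z : ℝ × ℝ, ∏ i, u i (form i z.1 z.2) ^ p i
      ≤ ENNReal.ofReal (Real.exp (logConst p / 2)) := by
  classical
  -- a function that enters with exponent `0` is replaced by a Gaussian density
  set v : Fin 3 → ℝ → ℝ≥0∞ := fun i =>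
    if p i = 0 then ProbabilityTheory.gaussianPDF 0 1 else u i with hv
  have hvu : ∀ z : ℝ × ℝ, ∏ i, u i (form i z.1 z.2) ^ p i = ∏ i, v i (form i z.1 z.2) ^ p i :=
    fun z => Finset.prod_congr rfl fun i _ => by
      by_cases h : p i = 0 <;> simp [hv, h]
  simp only [hvu]
  refine le_of_forall_gt_imp_ge_of_dense fun b hb => ?_
  rcases eq_or_ne b ∞ with rfl | hbt
  · exact le_top
  rw [← ENNReal.ofReal_toReal hbt] at hb ⊢
  obtain ⟨c, hc, hcK⟩ := exists_scaling hp hsum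
    ((ENNReal.ofReal_lt_ofReal_iff_of_nonneg (Real.exp_pos _).le).1 hb)
  refine (lintegral_prod_rpow_le_of_scaling hp hsum (fun i => ?_) (fun i => ?_) (fun i hi x => ?_)
    hc).trans (ENNReal.ofReal_le_ofReal hcK)
  · by_cases h : p i = 0
    · simpa [hv, h] using ProbabilityTheory.measurable_gaussianPDF 0 1
    · simpa [hv, h] using hu i
  · by_cases h : p i = 0
    · simp [hv, h]
    · simpa [hv, h] using h1 i h
  · simpa [hv, hi] using (ProbabilityTheory.gaussianPDF_pos 0 one_ne_zero x).ne'

/-- The sharp Young inequality on the line, in trilinear form. -/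
theorem lintegral_prod_rpow_le_real {p : Fin 3 → ℝ} (hp : ∀ i, p i ∈ Set.Icc (0 : ℝ) 1)
    (hsum : p 0 + p 1 + p 2 = 2) {u : Fin 3 → ℝ → ℝ≥0∞} (hu : ∀ i, Measurable (u i)) :
    ∫⁻ z : ℝ × ℝ, ∏ i, u i (form i z.1 z.2) ^ p i
      ≤ ENNReal.ofReal (Real.exp (logConst p / 2)) * ∏ i, (∫⁻ x, u i x) ^ p i := by
  by_cases hz : ∃ i, p i ≠ 0 ∧ ∫⁻ x, u i x = 0
  · obtain ⟨i, hpi, hi⟩ := hz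
    have h0 : ∀ᵐ z : ℝ × ℝ, u i (form i z.1 z.2) = 0 :=
      (quasiMeasurePreserving_form i).ae ((lintegral_eq_zero_iff (hu i)).1 hi)
    have : ∫⁻ z : ℝ × ℝ, ∏ i, u i (form i z.1 z.2) ^ p i = ∫⁻ _ : ℝ × ℝ, 0 :=
      lintegral_congr_ae (by
        filter_upwards [h0] with z hz
        refine Finset.prod_eq_zero (Finset.mem_univ i) ?_
        rw [hz, ENNReal.zero_rpow_of_pos ((hp i).1.lt_of_ne' hpi)])
    rw [this, lintegral_zero]
    exact zero_le
  push Not at hz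
  have hne : ∀ i, (∫⁻ x, u i x) ^ p i ≠ 0 := fun i => by
    rcases eq_or_ne (p i) 0 with h | h
    · simp [h]
    · exact (ENNReal.rpow_pos_of_nonneg (pos_iff_ne_zero.2 (hz i h)) (hp i).1).ne'
  by_cases htop : ∃ i, p i ≠ 0 ∧ ∫⁻ x, u i x = ∞
  · obtain ⟨i, hpi, hi⟩ := htop
    have : ∏ i, (∫⁻ x, u i x) ^ p i = ∞ := by
      rw [← Finset.mul_prod_erase _ _ (Finset.mem_univ i), hi,
        ENNReal.top_rpow_of_pos ((hp i).1.lt_of_ne' hpi),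
        ENNReal.top_mul (Finset.prod_ne_zero_iff.2 fun j _ => hne j)]
    rw [this, ENNReal.mul_top (ENNReal.ofReal_pos.2 (Real.exp_pos _)).ne']
    exact le_top
  push Not at htop
  have hnt : ∀ i, (∫⁻ x, u i x) ^ p i ≠ ∞ := fun i => by
    rcases eq_or_ne (p i) 0 with h | h
    · simp [h]
    · exact ENNReal.rpow_ne_top_of_nonneg (hp i).1 (htop i h)
  have hone := lintegral_prod_rpow_le_of_lintegral_eq_one hp hsum
    (u := fun i x => (∫⁻ x, u i x)⁻¹ * u i x) (fun i => (hu i).const_mul _) fun i hi => by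
      rw [lintegral_const_mul _ (hu i), ENNReal.inv_mul_cancel (hz i hi) (htop i hi)]
  simp only [ENNReal.mul_rpow_of_nonneg _ _ (hp _).1, ENNReal.inv_rpow,
    Finset.prod_mul_distrib] at hone
  rw [lintegral_const_mul _ (measurable_prod_form p hu)] at hone
  have hP0 : ∏ i, (∫⁻ x, u i x) ^ p i ≠ 0 := Finset.prod_ne_zero_iff.2 fun i _ => hne i
  have hPt : ∏ i, (∫⁻ x, u i x) ^ p i ≠ ∞ := ENNReal.prod_ne_top fun i _ => hnt i
  rw [← ENNReal.prod_inv_distrib (fun i _ j _ _ => Or.inl (hne i)), mul_comm,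
    ← div_eq_mul_inv, ENNReal.div_le_iff hP0 hPt] at hone
  exact hone

/-! ### The sharp Young inequality in higher dimensions -/

/-- The trilinear Young inequality on `E` with exponents `p` and constant `C`. -/
def YoungBound (E : Type*) [MeasureSpace E] [Add E] (p : Fin 3 → ℝ) (C : ℝ≥0∞) : Prop :=
  ∀ u : Fin 3 → E → ℝ≥0∞, (∀ i, Measurable (u i)) →
    ∫⁻ z : E × E, ∏ i, u i (form i z.1 z.2) ^ p i ≤ C * ∏ i, (∫⁻ x, u i x) ^ p i

/-- A product measure on `(E × F) × (E × F)` may be integrated over `E × E` last. -/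
theorem lintegral_prod_prod_comm {E F : Type*} [MeasureSpace E] [MeasureSpace F]
    [SFinite (volume : Measure E)] [SFinite (volume : Measure F)]
    {f : (E × F) × (E × F) → ℝ≥0∞} (hf : Measurable f) :
    ∫⁻ z, f z = ∫⁻ a : E × E, ∫⁻ b : F × F, f ((a.1, b.1), (a.2, b.2)) := by
  have hm : Measurable fun a : E × E => ∫⁻ b : F × F, f ((a.1, b.1), (a.2, b.2)) :=
    Measurable.lintegral_prod_right' (f := fun c : (E × E) × (F × F) =>
      f ((c.1.1, c.2.1), (c.1.2, c.2.2))) (by fun_prop)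
  rw [Measure.volume_eq_prod (E × F) (E × F), lintegral_prod _ hf.aemeasurable,
    Measure.volume_eq_prod E F,
    lintegral_prod _ (Measurable.lintegral_prod_right' hf).aemeasurable,
    Measure.volume_eq_prod E E, lintegral_prod _ hm.aemeasurable]
  refine lintegral_congr fun x => ?_
  have h1 : ∀ x', ∫⁻ y, f ((x, x'), y) ∂(volume.prod volume : Measure (E × F))
      = ∫⁻ y, ∫⁻ y', f ((x, x'), (y, y')) := fun x' => by
    rw [lintegral_prod _ (by fun_prop)]
  have h2 : ∀ y, ∫⁻ b : F × F, f ((x, b.1), (y, b.2))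
      = ∫⁻ x', ∫⁻ y', f ((x, x'), (y, y')) := fun y => by
    rw [Measure.volume_eq_prod F F, lintegral_prod _ (by fun_prop)]
  simp only [h1, h2]
  rw [lintegral_lintegral_swap]
  exact (Measurable.lintegral_prod_right' (f := fun c : (F × E) × F => f ((x, c.1.1), (c.1.2, c.2)))
    (by fun_prop)).aemeasurable

theorem form_prod {E F : Type*} [Add E] [Add F] (i : Fin 3) (x y : E × F) :
    form i x y = (form i x.1 y.1, form i x.2 y.2) := by
  fin_cases i <;> rfl

/-- Young bounds tensorize. -/
theorem YoungBound.prod {E F : Type*} [MeasureSpace E] [MeasureSpace F] [Add E] [Add F]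
    [MeasurableAdd₂ E] [MeasurableAdd₂ F]
    [SFinite (volume : Measure E)] [SFinite (volume : Measure F)] {p : Fin 3 → ℝ} {C D : ℝ≥0∞}
    (hE : YoungBound E p C) (hF : YoungBound F p D) : YoungBound (E × F) p (C * D) := by
  intro u hu
  have : MeasurableAdd₂ (E × F) := ⟨by
    change Measurable fun c : (E × F) × (E × F) => (c.1.1 + c.2.1, c.1.2 + c.2.2)
    fun_prop⟩
  rw [lintegral_prod_prod_comm (measurable_prod_form p hu)]
  have hU : ∀ i, Measurable fun x => ∫⁻ y, u i (x, y) := fun i => (hu i).lintegral_prod_right'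
  calc _ ≤ ∫⁻ a : E × E, D * ∏ i, (∫⁻ y, u i (form i a.1 a.2, y)) ^ p i :=
        lintegral_mono fun a => by
          simp only [form_prod]
          exact hF (fun i y => u i (form i a.1 a.2, y)) fun i =>
            (hu i).comp measurable_prodMk_left
    _ = D * ∫⁻ a : E × E, ∏ i, (∫⁻ y, u i (form i a.1 a.2, y)) ^ p i :=
        lintegral_const_mul _ (measurable_prod_form p hU)
    _ ≤ D * (C * ∏ i, (∫⁻ x, ∫⁻ y, u i (x, y)) ^ p i) := by
        gcongr
        exact hE (fun i x => ∫⁻ y, u i (x, y)) hU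
    _ = _ := by
        rw [← mul_assoc, mul_comm D]
        congr 1
        refine Finset.prod_congr rfl fun i _ => ?_
        rw [Measure.volume_eq_prod E F, lintegral_prod _ (hu i).aemeasurable]

theorem YoungBound.of_measurableEquiv {E F : Type*} [MeasureSpace E] [MeasureSpace F] [Add E]
    [Add F] [SFinite (volume : Measure E)] [SFinite (volume : Measure F)] {p : Fin 3 → ℝ}
    {C : ℝ≥0∞} (hF : YoungBound F p C) (e : E ≃ᵐ F) (he : MeasurePreserving e)
    (hadd : ∀ x y, e (x + y) = e x + e y) : YoungBound E p C := by
  intro u hu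
  have hform : ∀ i x y, e (form i x y) = form i (e x) (e y) := fun i x y => by
    fin_cases i
    · rfl
    · rfl
    · exact hadd x y
  have h := hF (fun i y => u i (e.symm y)) fun i => (hu i).comp e.symm.measurable
  have hee : MeasurePreserving (e.prodCongr e) (volume : Measure (E × E)) volume := he.prod he
  rw [← hee.lintegral_comp_emb (e.prodCongr e).measurableEmbedding] at h
  have hi : ∀ i, ∫⁻ y, u i (e.symm y) = ∫⁻ x, u i x := fun i => by
    rw [← he.lintegral_comp_emb e.measurableEmbedding]
    simp
  simp only [hi] at h
  refine le_trans (le_of_eq (lintegral_congr fun z => ?_)) h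
  refine Finset.prod_congr rfl fun i _ => ?_
  change _ = u i (e.symm (form i (e z.1) (e z.2))) ^ p i
  rw [← hform, e.symm_apply_apply]

/-- The sharp Young inequality on `ℝⁿ`, in trilinear form. -/
theorem youngBound_pi {p : Fin 3 → ℝ} (hp : ∀ i, p i ∈ Set.Icc (0 : ℝ) 1)
    (hsum : p 0 + p 1 + p 2 = 2) (n : ℕ) :
    YoungBound (Fin n → ℝ) p (ENNReal.ofReal (Real.exp (n / 2 * logConst p))) := by
  induction n with
  | zero =>
    intro u _
    have hvol : (volume : Measure (Fin 0 → ℝ)) = Measure.dirac default := by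
      rw [volume_pi, Measure.pi_of_empty _ default]
    rw [Measure.volume_eq_prod, hvol, Measure.dirac_prod_dirac, lintegral_dirac]
    have hform : ∀ i, form i (default : Fin 0 → ℝ) default = default :=
      fun i => Subsingleton.elim _ _
    simp only [hform, lintegral_dirac]
    simp
  | succ n ih =>
    have h1 : YoungBound ℝ p (ENNReal.ofReal (Real.exp (logConst p / 2))) :=
      fun u hu => lintegral_prod_rpow_le_real hp hsum hu
    have h2 := (h1.prod ih).of_measurableEquiv
      (MeasurableEquiv.piFinSuccAbove (fun _ : Fin (n + 1) => ℝ) 0)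
      (volume_preserving_piFinSuccAbove (fun _ => ℝ) 0) fun x y => rfl
    rw [← ENNReal.ofReal_mul (Real.exp_pos _).le, ← Real.exp_add] at h2
    convert h2 using 3
    push_cast
    ring

/-! ### Entropy inequalities from the Young inequality -/

instance sigmaFinite_refMeasure (ι : Type) [Fintype ι] : SigmaFinite (refMeasure ι) :=
  inferInstanceAs (SigmaFinite
    (((2 * Real.pi) ^ (-(Fintype.card ι : ℝ) / 2)).toNNReal • (volume : Measure (ι → ℝ))))

theorem measurable_density {ι : Type} [Fintype ι] (μ : Measure (ι → ℝ)) : Measurable (density μ) :=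
  (Measure.measurable_rnDeriv μ _).ennreal_toReal

theorem entropyPos_ne_top_of_integrable {ι : Type} [Fintype ι] {μ : Measure (ι → ℝ)}
    (h : Integrable (fun x => Real.log (density μ x)) μ) : entropyPos μ ≠ ∞ :=
  h.neg.lintegral_lt_top.ne

theorem entropyNeg_ne_top_of_integrable {ι : Type} [Fintype ι] {μ : Measure (ι → ℝ)}
    (h : Integrable (fun x => Real.log (density μ x)) μ) : entropyNeg μ ≠ ∞ :=
  h.lintegral_lt_top.ne

theorem entropy_eq_of_integrable {ι : Type} [Fintype ι] {μ : Measure (ι → ℝ)}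
    (h : Integrable (fun x => Real.log (density μ x)) μ) :
    entropy μ = ((-∫ x, Real.log (density μ x) ∂μ : ℝ) : EReal) := by
  have h1 := entropyPos_ne_top_of_integrable h
  have h2 := entropyNeg_ne_top_of_integrable h
  rw [integral_eq_lintegral_pos_part_sub_lintegral_neg_part h, neg_sub, EReal.coe_sub]
  exact (congrArg₂ _ (EReal.coe_ennreal_toReal h1) (EReal.coe_ennreal_toReal h2)).symm

theorem integrable_log_density_of_hasFiniteEntropy {ι : Type} [Fintype ι] {μ : Measure (ι → ℝ)}
    (h : HasFiniteEntropy μ) : Integrable (fun x => Real.log (density μ x)) μ := by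
  refine ⟨(Real.measurable_log.comp (measurable_density μ)).aestronglyMeasurable, ?_⟩
  rw [hasFiniteIntegral_iff_norm]
  have : ∀ x, ENNReal.ofReal ‖Real.log (density μ x)‖ ≤
      ENNReal.ofReal (-Real.log (density μ x)) + ENNReal.ofReal (Real.log (density μ x)) :=
    fun x => by
      rw [Real.norm_eq_abs]
      rcases abs_cases (Real.log (density μ x)) with ⟨h, _⟩ | ⟨h, _⟩ <;> rw [h]
      · exact le_add_self
      · exact le_self_add
  refine (lintegral_mono this).trans_lt ?_
  rw [lintegral_add_left (by have := measurable_density μ; fun_prop)]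
  exact ENNReal.add_lt_top.2 ⟨h.2.1.lt_top, h.2.2.lt_top⟩

/-- Gibbs' inequality with a weighted sum of logarithms. If the exponential of
`∑ i, p i * ψ i - φ` has mean at most `K`, then its positive part is integrable, which makes every
`ψ i` with a positive weight integrable as soon as the negative parts are. -/
theorem integrable_and_sum_integral_le_log {α : Type*} [MeasurableSpace α] {μ : Measure α}
    [IsProbabilityMeasure μ] {p : Fin 3 → ℝ} (hp : ∀ i, 0 ≤ p i) {ψ : Fin 3 → α → ℝ} {φ : α → ℝ}
    (hψ : ∀ i, Measurable (ψ i)) (hφm : Measurable φ) (hφ : Integrable φ μ)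
    (hneg : ∀ i, p i ≠ 0 → ∫⁻ x, ENNReal.ofReal (-ψ i x) ∂μ ≠ ∞) {K : ℝ} (hK : 0 < K)
    (hexp : ∫⁻ x, ENNReal.ofReal (Real.exp (∑ i, p i * ψ i x - φ x)) ∂μ ≤ ENNReal.ofReal K) :
    (∀ i, p i ≠ 0 → Integrable (ψ i) μ) ∧
      ∑ i, p i * ∫ x, ψ i x ∂μ - ∫ x, φ x ∂μ ≤ Real.log K := by
  set E : α → ℝ := fun x => Real.exp (∑ i, p i * ψ i x - φ x) with hE
  have hEm : Measurable E := by fun_prop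
  have hEi : Integrable E μ := by
    refine ⟨hEm.aestronglyMeasurable, ?_⟩
    rw [hasFiniteIntegral_iff_ofReal (Filter.Eventually.of_forall fun x => (Real.exp_pos _).le)]
    exact hexp.trans_lt ENNReal.ofReal_lt_top
  have hEle : ∫ x, E x ∂μ ≤ K := by
    rw [integral_eq_lintegral_of_nonneg_ae
      (Filter.Eventually.of_forall fun x => (Real.exp_pos _).le) hEm.aestronglyMeasurable]
    exact ENNReal.toReal_le_of_le_ofReal hK.le hexp
  set N : Fin 3 → α → ℝ := fun i x => p i * max (-ψ i x) 0 with hN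
  have hN0 : ∀ i x, 0 ≤ N i x := fun i x => mul_nonneg (hp i) (le_max_right _ _)
  have hNi : ∀ i, Integrable (N i) μ := fun i => by
    rcases eq_or_ne (p i) 0 with h | h
    · simp [hN, h]
    · refine Integrable.const_mul ⟨by have := hψ i; fun_prop, ?_⟩ _
      rw [hasFiniteIntegral_iff_ofReal (f := fun x => max (-ψ i x) 0)
        (Filter.Eventually.of_forall fun x => le_max_right _ _)]
      simpa [ENNReal.ofReal_max] using (hneg i h).lt_top
  have hdom : ∀ i x, |p i * ψ i x| ≤ E x + |φ x| + ∑ j, N j x := fun i x => by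
    have hlow : ∀ j, -N j x ≤ p j * ψ j x := fun j => by
      have h := mul_le_mul_of_nonneg_left (le_max_left (-ψ j x) 0) (hp j)
      simp only [hN]
      linarith
    have hEx : ∑ j, p j * ψ j x - φ x + 1 ≤ E x := Real.add_one_le_exp _
    have hE0 : 0 < E x := Real.exp_pos _
    have hφx := le_abs_self (φ x)
    have hsum := Finset.sum_le_sum fun j (_ : j ∈ Finset.univ.erase i) => hlow j
    rw [Finset.sum_neg_distrib] at hsum
    have e1 := Finset.add_sum_erase Finset.univ (fun j => p j * ψ j x) (Finset.mem_univ i)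
    have e2 := Finset.add_sum_erase Finset.univ (fun j => N j x) (Finset.mem_univ i)
    have h3 := Finset.sum_nonneg fun j (_ : j ∈ Finset.univ.erase i) => hN0 j x
    have := hlow i; have := hN0 i x
    have := abs_nonneg (φ x)
    rw [abs_le]
    constructor <;> linarith
  have hint : ∀ i, Integrable (fun x => p i * ψ i x) μ := fun i =>
    ((hEi.add hφ.abs).add (integrable_finsetSum _ fun j _ => hNi j)).mono'
      (by have := hψ i; fun_prop) (Filter.Eventually.of_forall fun x => by
        simpa [Finset.sum_apply] using hdom i x)
  refine ⟨fun i hi => (integrable_const_mul_iff (Ne.isUnit hi) _).1 (hint i), ?_⟩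
  have hpt : ∀ x, ∑ i, p i * ψ i x - φ x ≤ E x / K + (Real.log K - 1) := fun x => by
    have h := Real.add_one_le_exp (∑ i, p i * ψ i x - φ x - Real.log K)
    rw [Real.exp_sub _ (Real.log K), Real.exp_log hK] at h
    simp only [hE]
    linarith
  have hsumi : Integrable (fun x => ∑ i, p i * ψ i x) μ := integrable_finsetSum _ fun i _ => hint i
  have hle := integral_mono (hsumi.sub hφ) ((hEi.div_const K).add (integrable_const _)) hpt
  simp only [Pi.sub_apply, Pi.add_apply] at hle
  rw [integral_sub hsumi hφ, integral_add (hEi.div_const K) (integrable_const _),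
    integral_finsetSum _ fun i _ => hint i, integral_div] at hle
  simp only [integral_const_mul, integral_const, probReal_univ, one_smul] at hle
  have : (∫ x, E x ∂μ) / K ≤ 1 := (div_le_one hK).2 hEle
  linarith

theorem standardDatum_mulVec (n : ℕ) (i : Fin 3) (x : Fin n ⊕ Fin n → ℝ) :
    ((standardDatum n).mat i).mulVec x = form i (x ∘ Sum.inl) (x ∘ Sum.inr) := by
  fin_cases i <;> simp [standardDatum, form, Matrix.fromCols_mulVec]

theorem measurable_standardDatum_mulVec (n : ℕ) (i : Fin 3) :
    Measurable fun x => ((standardDatum n).mat i).mulVec x := by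
  fun_prop

theorem lintegral_refMeasure {ι : Type} [Fintype ι] (f : (ι → ℝ) → ℝ≥0∞) :
    ∫⁻ x, f x ∂refMeasure ι
      = ENNReal.ofReal ((2 * Real.pi) ^ (-(Fintype.card ι : ℝ) / 2)) * ∫⁻ x, f x := by
  rw [refMeasure, lintegral_smul_measure, smul_eq_mul]

/-- The sharp Young inequality with respect to the reference measures. The powers of `2 * π` cancel
because the exponents have sum `2`. -/
theorem lintegral_refMeasure_prod_rpow_le {p : Fin 3 → ℝ} (hp : ∀ i, p i ∈ Set.Icc (0 : ℝ) 1)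
    (hsum : p 0 + p 1 + p 2 = 2) (n : ℕ) {u : Fin 3 → (Fin n → ℝ) → ℝ≥0∞}
    (hu : ∀ i, Measurable (u i)) :
    ∫⁻ x, ∏ i, u i (((standardDatum n).mat i).mulVec x) ^ p i ∂refMeasure (Fin n ⊕ Fin n)
      ≤ ENNReal.ofReal (Real.exp (n / 2 * logConst p))
        * ∏ i, (∫⁻ x, u i x ∂refMeasure (Fin n)) ^ p i := by
  simp only [lintegral_refMeasure]
  have hvol : ∫⁻ x : Fin n ⊕ Fin n → ℝ, ∏ i, u i (((standardDatum n).mat i).mulVec x) ^ p i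
      = ∫⁻ z : (Fin n → ℝ) × (Fin n → ℝ), ∏ i, u i (form i z.1 z.2) ^ p i := by
    rw [← (volume_measurePreserving_sumPiEquivProdPi
      (fun _ : Fin n ⊕ Fin n => ℝ)).lintegral_comp_emb
        (MeasurableEquiv.measurableEmbedding _)]
    simp only [standardDatum_mulVec]
    rfl
  have hconst : ENNReal.ofReal ((2 * Real.pi) ^ (-(Fintype.card (Fin n ⊕ Fin n) : ℝ) / 2))
      = ∏ i, ENNReal.ofReal ((2 * Real.pi) ^ (-(Fintype.card (Fin n) : ℝ) / 2)) ^ p i := by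
    have hpos : (0 : ℝ) < 2 * Real.pi := by positivity
    simp only [ENNReal.ofReal_rpow_of_pos (Real.rpow_pos_of_pos hpos _), ← Real.rpow_mul hpos.le]
    rw [← ENNReal.ofReal_prod_of_nonneg fun i _ => (Real.rpow_pos_of_pos hpos _).le,
      ← Real.rpow_sum_of_pos hpos]
    congr 2
    simp only [Fintype.card_sum, Fintype.card_fin, Fin.sum_univ_three]
    push_cast
    linear_combination ((n : ℝ) / 2) * hsum
  rw [hvol]
  simp only [ENNReal.mul_rpow_of_nonneg _ _ (hp _).1, Finset.prod_mul_distrib]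
  rw [← hconst, mul_left_comm]
  gcongr
  exact youngBound_pi hp hsum n u hu

theorem isProbabilityMeasure_image {n : ℕ} (i : Fin 3) {μ : Measure (Fin n ⊕ Fin n → ℝ)}
    [IsProbabilityMeasure μ] : IsProbabilityMeasure ((standardDatum n).image i μ) :=
  Measure.isProbabilityMeasure_map (measurable_standardDatum_mulVec n i).aemeasurable

/-- The upper bound for laws all of whose relevant marginal entropies are less than `∞`. These are
then finite, and the sharp Young inequality is applied to the marginal densities. -/
theorem integrable_and_sum_integral_log_density_le {n : ℕ} {p : Fin 3 → ℝ}
    (hp : ∀ i, p i ∈ Set.Icc (0 : ℝ) 1) (hsum : p 0 + p 1 + p 2 = 2)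
    {μ : Measure (Fin n ⊕ Fin n → ℝ)} [IsProbabilityMeasure μ] (hμ : HasFiniteEntropy μ)
    (hac : ∀ i, p i ≠ 0 → (standardDatum n).image i μ ≪ refMeasure (Fin n))
    (hpos : ∀ i, p i ≠ 0 → entropyPos ((standardDatum n).image i μ) ≠ ∞) :
    (∀ i, p i ≠ 0 → Integrable (fun y => Real.log (density ((standardDatum n).image i μ) y))
        ((standardDatum n).image i μ)) ∧
      ∑ i, p i * ∫ y, Real.log (density ((standardDatum n).image i μ) y)
        ∂((standardDatum n).image i μ) - ∫ x, Real.log (density μ x) ∂μ ≤ n / 2 * logConst p := by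
  have hm := measurable_standardDatum_mulVec n
  have hlm : ∀ i, Measurable fun y => Real.log (density ((standardDatum n).image i μ) y) :=
    fun i => Real.measurable_log.comp (measurable_density _)
  have hprob : ∀ i, IsProbabilityMeasure ((standardDatum n).image i μ) :=
    fun i => isProbabilityMeasure_image i
  set f : (Fin n ⊕ Fin n → ℝ) → ℝ≥0∞ := μ.rnDeriv (refMeasure _) with hf
  set g : Fin 3 → (Fin n → ℝ) → ℝ≥0∞ :=
    fun i => ((standardDatum n).image i μ).rnDeriv (refMeasure _) with hg
  have hgm : ∀ i, Measurable (g i) := fun i => Measure.measurable_rnDeriv _ _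
  have hY : ∫⁻ x, ∏ i, g i (((standardDatum n).mat i).mulVec x) ^ p i ∂refMeasure _
      ≤ ENNReal.ofReal (Real.exp (n / 2 * logConst p)) := by
    refine (lintegral_refMeasure_prod_rpow_le hp hsum n hgm).trans ?_
    refine mul_le_of_le_one_right' (Finset.prod_le_one' fun i _ => ?_)
    refine ENNReal.rpow_le_one ?_ (hp i).1
    exact (Measure.lintegral_rnDeriv_le).trans_eq measure_univ
  have hgae : ∀ᵐ x ∂μ, ∀ i, p i ≠ 0 → 0 < g i (((standardDatum n).mat i).mulVec x) ∧
      g i (((standardDatum n).mat i).mulVec x) < ∞ := by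
    refine ae_all_iff.2 fun i => ?_
    by_cases hi : p i = 0
    · exact Filter.Eventually.of_forall fun x h => absurd hi h
    · filter_upwards [ae_of_ae_map (hm i).aemeasurable (Measure.rnDeriv_pos (hac i hi)),
        ae_of_ae_map (hm i).aemeasurable ((hac i hi).ae_le (Measure.rnDeriv_lt_top
          ((standardDatum n).image i μ) (refMeasure (Fin n))))]
        with x h1 h2 _
      exact ⟨h1, h2⟩
  have hexp : ∫⁻ x, ENNReal.ofReal (Real.exp (∑ i, p i *
      Real.log (density ((standardDatum n).image i μ) (((standardDatum n).mat i).mulVec x))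
        - Real.log (density μ x))) ∂μ ≤ ENNReal.ofReal (Real.exp (n / 2 * logConst p)) := by
    refine le_trans ?_ hY
    have hfm : Measurable f := Measure.measurable_rnDeriv _ _
    have hGm : Measurable fun x => ∏ i, g i (((standardDatum n).mat i).mulVec x) ^ p i :=
      Finset.measurable_prod _ fun i _ => ((hgm i).comp (hm i)).pow_const _
    calc _ = ∫⁻ x, (∏ i, g i (((standardDatum n).mat i).mulVec x) ^ p i) / f x ∂μ := by
          refine lintegral_congr_ae ?_
          filter_upwards [hgae, Measure.rnDeriv_pos hμ.1,
            hμ.1.ae_le (Measure.rnDeriv_lt_top μ _)] with x hx hfp hft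
          have hfr : 0 < density μ x := ENNReal.toReal_pos hfp.ne' hft.ne
          rw [Real.exp_sub, Real.exp_log hfr, Real.exp_sum, ENNReal.ofReal_div_of_pos hfr,
            ENNReal.ofReal_prod_of_nonneg fun i _ => (Real.exp_pos _).le]
          congr 1
          · refine Finset.prod_congr rfl fun i _ => ?_
            by_cases hi : p i = 0
            · simp [hi]
            · have hgr : 0 < density ((standardDatum n).image i μ)
                  (((standardDatum n).mat i).mulVec x) :=
                ENNReal.toReal_pos (hx i hi).1.ne' (hx i hi).2.ne
              rw [mul_comm, ← Real.rpow_def_of_pos hgr, ← ENNReal.ofReal_rpow_of_pos hgr, density,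
                ENNReal.ofReal_toReal (hx i hi).2.ne]
          · rw [density, ENNReal.ofReal_toReal hft.ne]
      _ = ∫⁻ x, f x * ((∏ i, g i (((standardDatum n).mat i).mulVec x) ^ p i) / f x)
            ∂refMeasure _ := by
          exact (lintegral_rnDeriv_mul hμ.1 (hGm.div hfm).aemeasurable).symm
      _ ≤ _ := lintegral_mono fun x => ENNReal.mul_div_le
  have hneg : ∀ i, p i ≠ 0 → ∫⁻ x, ENNReal.ofReal (-Real.log (density
      ((standardDatum n).image i μ) (((standardDatum n).mat i).mulVec x))) ∂μ ≠ ∞ := fun i hi => by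
    have h := hpos i hi
    rw [entropyPos, Datum.image, lintegral_map (by exact (hlm i).neg.ennreal_ofReal) (hm i)] at h
    exact h
  obtain ⟨h1, h2⟩ := integrable_and_sum_integral_le_log (fun i => (hp i).1)
    (fun i => (hlm i).comp (hm i)) (Real.measurable_log.comp (measurable_density μ))
    (integrable_log_density_of_hasFiniteEntropy hμ) hneg (Real.exp_pos _) hexp
  refine ⟨fun i hi => (integrable_map_measure (hlm i).aestronglyMeasurable
    (hm i).aemeasurable).2 (h1 i hi), ?_⟩
  rw [Real.log_exp] at h2
  refine le_trans (le_of_eq ?_) h2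
  congr 1
  refine Finset.sum_congr rfl fun i _ => ?_
  congr 1
  exact integral_map (hm i).aemeasurable (hlm i).aestronglyMeasurable

theorem sum_three_eq_top {a : Fin 3 → EReal} (hbot : ∀ i, a i ≠ ⊥) {i : Fin 3} (hi : a i = ⊤) :
    ∑ j, a j = ⊤ := by
  rw [Fin.sum_univ_three]
  fin_cases i <;> simp only [Fin.zero_eta, Fin.mk_one, Fin.reduceFinMk] at hi <;> rw [hi]
  · rw [EReal.top_add_of_ne_bot (hbot 1), EReal.top_add_of_ne_bot (hbot 2)]
  · rw [EReal.add_top_of_ne_bot (hbot 0), EReal.top_add_of_ne_bot (hbot 2)]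
  · rw [EReal.add_top_of_ne_bot]
    rw [Ne, EReal.add_eq_bot_iff]
    exact not_or.2 ⟨hbot 0, hbot 1⟩

theorem constant_standardDatum_le {n : ℕ} {p : Fin 3 → ℝ} (hp : ∀ i, p i ∈ Set.Icc (0 : ℝ) 1)
    (hsum : p 0 + p 1 + p 2 = 2) :
    (standardDatum n).constant p ≤ ((n / 2 * logConst p : ℝ) : EReal) := by
  refine iSup₂_le fun μ hμ => ?_
  have := hμ.isProbabilityMeasure
  by_cases htop : ∃ i, p i ≠ 0 ∧ entropy ((standardDatum n).image i μ) = ⊤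
  · -- one marginal entropy is `∞`, so none is `-∞` and the functional takes the value `-∞`
    obtain ⟨i, hi, hS⟩ := htop
    have hsumtop : ∑ i, (p i : EReal) * entropy ((standardDatum n).image i μ) = ⊤ := by
      refine sum_three_eq_top (i := i) (fun j => ?_) ?_
      · rcases (hp j).1.eq_or_lt with hj | hj
        · simp [← hj]
        · have hb : entropy ((standardDatum n).image j μ) ≠ ⊥ := fun hb =>
            hμ.not_indeterminate ⟨i, j, hi, hj.ne', hS, hb⟩
          induction h : entropy ((standardDatum n).image j μ) with
          | bot => exact absurd h hb
          | top => simp [EReal.coe_mul_top_of_pos hj]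
          | coe x => rw [← EReal.coe_mul]; exact EReal.coe_ne_bot _
      · rw [hS, EReal.coe_mul_top_of_pos ((hp i).1.lt_of_ne' hi)]
    rw [hsumtop, EReal.sub_top]
    exact bot_le
  · push Not at htop
    have hpos : ∀ i, p i ≠ 0 → entropyPos ((standardDatum n).image i μ) ≠ ∞ := fun i hi h => by
      have hneg := (hμ.hasEntropy_image i hi).2.resolve_left (not_not.2 h)
      refine htop i hi ?_
      rw [entropy, h, ← EReal.coe_ennreal_toReal hneg, EReal.coe_ennreal_top, EReal.top_sub_coe]
    obtain ⟨h1, h2⟩ := integrable_and_sum_integral_log_density_le hp hsum hμ.hasFiniteEntropy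
      (fun i hi => (hμ.hasEntropy_image i hi).1) hpos
    have hterm : ∀ i, (p i : EReal) * entropy ((standardDatum n).image i μ)
        = ((p i * -∫ y, Real.log (density ((standardDatum n).image i μ) y)
        ∂((standardDatum n).image i μ) : ℝ) : EReal) := fun i => by
      by_cases hi : p i = 0
      · simp [hi]
      · rw [entropy_eq_of_integrable (h1 i hi), EReal.coe_mul]
    rw [Finset.sum_congr rfl fun i _ => hterm i, entropy_eq_of_integrable
      (integrable_log_density_of_hasFiniteEntropy hμ.hasFiniteEntropy), Fin.sum_univ_three,
      ← EReal.coe_add, ← EReal.coe_add, ← EReal.coe_sub, EReal.coe_le_coe_iff]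
    rw [Fin.sum_univ_three] at h2
    linarith

/-! ### Entropy of Gaussian laws -/

/-- The standard Gaussian law on `ℝ^ι`. -/
noncomputable def stdGaussian (ι : Type) [Fintype ι] : Measure (ι → ℝ) :=
  Measure.pi fun _ => ProbabilityTheory.gaussianReal 0 1

instance isProbabilityMeasure_stdGaussian (ι : Type) [Fintype ι] :
    IsProbabilityMeasure (stdGaussian ι) :=
  inferInstanceAs (IsProbabilityMeasure (Measure.pi _))

theorem lintegral_pi_prod {ι : Type} [Fintype ι] {μ : ι → Measure ℝ}
    [∀ i, IsProbabilityMeasure (μ i)] {f : ι → ℝ → ℝ≥0∞} (hf : ∀ i, Measurable (f i)) :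
    ∫⁻ x, ∏ i, f i (x i) ∂Measure.pi μ = ∏ i, ∫⁻ x, f i x ∂μ i := by
  rw [ProbabilityTheory.lintegral_prod_eq_prod_lintegral_of_indepFun Finset.univ
    (fun i (x : ι → ℝ) => f i (x i))
    (ProbabilityTheory.iIndepFun_pi fun i => (hf i).aemeasurable)
    fun i => (hf i).comp (measurable_pi_apply i)]
  exact Finset.prod_congr rfl fun i _ => (measurePreserving_eval μ i).lintegral_comp (hf i)

theorem stdGaussian_eq_withDensity_volume (ι : Type) [Fintype ι] :
    stdGaussian ι = (volume : Measure (ι → ℝ)).withDensity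
      fun x => ∏ i, ProbabilityTheory.gaussianPDF 0 1 (x i) := by
  have hm := ProbabilityTheory.measurable_gaussianPDF 0 1
  have hmi : Measurable fun t => (ProbabilityTheory.gaussianPDF 0 1 t)⁻¹ := hm.inv
  have h0 : ∀ x : ℝ, ProbabilityTheory.gaussianPDF 0 1 x ≠ 0 := fun x =>
    (ProbabilityTheory.gaussianPDF_pos 0 one_ne_zero x).ne'
  -- independence is available under the Gaussian law only, so Lebesgue measure is described by
  -- its density with respect to that law
  have hvol : (volume : Measure (ι → ℝ)) = (stdGaussian ι).withDensity
      fun x => ∏ i, (ProbabilityTheory.gaussianPDF 0 1 (x i))⁻¹ := by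
    rw [volume_pi]
    refine Measure.pi_eq fun s hs => ?_
    rw [withDensity_apply _ (MeasurableSet.univ_pi hs),
      ← lintegral_indicator (MeasurableSet.univ_pi hs)]
    have hind : ∀ x : ι → ℝ, (Set.univ.pi s).indicator
        (fun x => ∏ i, (ProbabilityTheory.gaussianPDF 0 1 (x i))⁻¹) x
        = ∏ i, (s i).indicator (fun t => (ProbabilityTheory.gaussianPDF 0 1 t)⁻¹) (x i) :=
      fun x => by
        by_cases hx : x ∈ Set.univ.pi s
        · rw [Set.indicator_of_mem hx]
          exact Finset.prod_congr rfl fun i _ =>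
            (Set.indicator_of_mem (hx i (Set.mem_univ i))
              fun t => (ProbabilityTheory.gaussianPDF 0 1 t)⁻¹).symm
        · rw [Set.indicator_of_notMem hx]
          simp only [Set.mem_univ_pi, not_forall] at hx
          obtain ⟨i, hi⟩ := hx
          exact (Finset.prod_eq_zero (Finset.mem_univ i) (Set.indicator_of_notMem hi _)).symm
    simp only [hind]
    rw [stdGaussian, lintegral_pi_prod fun i => hmi.indicator (hs i)]
    refine Finset.prod_congr rfl fun i _ => ?_
    rw [lintegral_indicator (hs i), ProbabilityTheory.gaussianReal_of_var_ne_zero 0 one_ne_zero,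
      setLIntegral_withDensity_eq_setLIntegral_mul _ hm hmi (hs i)]
    simp [ENNReal.mul_inv_cancel (h0 _) ProbabilityTheory.gaussianPDF_ne_top]
  have hprod : Measurable fun x : ι → ℝ => ∏ i, (ProbabilityTheory.gaussianPDF 0 1 (x i))⁻¹ :=
    Finset.measurable_prod _ fun i _ => (hm.comp (measurable_pi_apply i)).inv
  have hinv := withDensity_inv_same (μ := stdGaussian ι) hprod
    (Filter.Eventually.of_forall fun x => Finset.prod_ne_zero_iff.2 fun i _ =>
      ENNReal.inv_ne_zero.2 ProbabilityTheory.gaussianPDF_ne_top)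
    (Filter.Eventually.of_forall fun x => ENNReal.prod_ne_top fun i _ =>
      ENNReal.inv_ne_top.2 (h0 _))
  rw [← hvol] at hinv
  rw [← hinv]
  congr 1
  funext x
  rw [← ENNReal.prod_inv_distrib fun i _ j _ _ => Or.inl (h0 _), inv_inv]

/-- With respect to the reference measure, the density of the standard Gaussian law has no
normalization constant. -/
theorem stdGaussian_eq_withDensity (ι : Type) [Fintype ι] :
    stdGaussian ι = (refMeasure ι).withDensity
      fun x => ENNReal.ofReal (Real.exp (-(∑ i, x i ^ 2) / 2)) := by
  rw [stdGaussian_eq_withDensity_volume, refMeasure, withDensity_smul_measure,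
    ← withDensity_smul _ (by fun_prop)]
  congr 1
  funext x
  rw [Pi.smul_apply, smul_eq_mul, ← ENNReal.ofReal_mul (by positivity)]
  simp only [ProbabilityTheory.gaussianPDF]
  rw [← ENNReal.ofReal_prod_of_nonneg fun i _ => ProbabilityTheory.gaussianPDFReal_nonneg 0 1 _]
  congr 1
  simp only [ProbabilityTheory.gaussianPDFReal, Finset.prod_mul_distrib, ← Real.exp_sum]
  congr 1
  · rw [Finset.prod_const, Finset.card_univ, Real.sqrt_eq_rpow, ← Real.rpow_neg (by positivity),
      ← Real.rpow_natCast, ← Real.rpow_mul (by positivity)]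
    simp only [NNReal.coe_one, mul_one]
    congr 1
    ring
  · simp [Finset.sum_div, neg_div]

theorem map_withDensity_comp {α β : Type*} [MeasurableSpace α] [MeasurableSpace β] (μ : Measure α)
    {g : α → β} (hg : Measurable g) {k : β → ℝ≥0∞} (hk : Measurable k) :
    (μ.withDensity fun x => k (g x)).map g = (μ.map g).withDensity k := by
  ext s hs
  rw [Measure.map_apply hg hs, withDensity_apply _ (hg hs), withDensity_apply _ hs,
    setLIntegral_map hs hk hg]

/-- The density of a nondegenerate centred Gaussian law. -/
theorem map_mulVec_stdGaussian {ι : Type} [Fintype ι] [DecidableEq ι] {M : Matrix ι ι ℝ}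
    (hM : M.det ≠ 0) :
    (stdGaussian ι).map M.mulVec = (refMeasure ι).withDensity fun y =>
      ENNReal.ofReal (|M.det|⁻¹ * Real.exp (-(∑ i, (M⁻¹.mulVec y) i ^ 2) / 2)) := by
  have hu : IsUnit M.det := isUnit_iff_ne_zero.2 hM
  have hg : Measurable M.mulVec := by fun_prop
  have hk : Measurable fun y => ENNReal.ofReal (Real.exp (-(∑ i, (M⁻¹.mulVec y) i ^ 2) / 2)) := by
    fun_prop
  have hcomp : stdGaussian ι = (refMeasure ι).withDensity fun x =>
      (fun y => ENNReal.ofReal (Real.exp (-(∑ i, (M⁻¹.mulVec y) i ^ 2) / 2))) (M.mulVec x) := by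
    rw [stdGaussian_eq_withDensity]
    simp [Matrix.mulVec_mulVec, Matrix.nonsing_inv_mul M hu]
  have hvol : (refMeasure ι).map M.mulVec = ENNReal.ofReal |M.det|⁻¹ • refMeasure ι := by
    have h := Real.map_matrix_volume_pi_eq_smul_volume_pi hM
    rw [abs_inv] at h
    rw [refMeasure, Measure.map_smul, show M.mulVec = ⇑(Matrix.toLin' M) from rfl, h, smul_comm]
  rw [hcomp, map_withDensity_comp _ hg hk, hvol, withDensity_smul_measure,
    ← withDensity_smul _ hk]
  congr 1
  funext y
  rw [Pi.smul_apply, smul_eq_mul, ← ENNReal.ofReal_mul (by positivity)]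

theorem integrable_sq_gaussianReal :
    Integrable (fun x : ℝ => x ^ 2) (ProbabilityTheory.gaussianReal 0 1) :=
  (ProbabilityTheory.memLp_id_gaussianReal 2).integrable_sq

theorem integral_sq_gaussianReal : ∫ x : ℝ, x ^ 2 ∂ProbabilityTheory.gaussianReal 0 1 = 1 := by
  have h := ProbabilityTheory.variance_of_integral_eq_zero (X := fun x : ℝ => x)
    (μ := ProbabilityTheory.gaussianReal 0 1) aemeasurable_id (by simp)
  rw [ProbabilityTheory.variance_fun_id_gaussianReal] at h
  simpa using h.symm

/-- A nondegenerate Gaussian law has finite entropy. -/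
theorem entropy_map_mulVec_stdGaussian {ι : Type} [Fintype ι] [DecidableEq ι] {M : Matrix ι ι ℝ}
    (hM : M.det ≠ 0) :
    HasFiniteEntropy ((stdGaussian ι).map M.mulVec) ∧ entropy ((stdGaussian ι).map M.mulVec)
      = ((Fintype.card ι / 2 + Real.log |M.det| : ℝ) : EReal) := by
  have hu : IsUnit M.det := isUnit_iff_ne_zero.2 hM
  set μ := (stdGaussian ι).map M.mulVec with hμ
  have hg : Measurable M.mulVec := by fun_prop
  have hd := map_mulVec_stdGaussian hM
  have hac : μ ≪ refMeasure ι := by rw [hμ, hd]; exact withDensity_absolutelyContinuous _ _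
  have hdens : ∀ᵐ y ∂μ, Real.log (density μ y)
      = -(∑ i, (M⁻¹.mulVec y) i ^ 2) / 2 - Real.log |M.det| := by
    have h : ∀ᵐ y ∂refMeasure ι, μ.rnDeriv (refMeasure ι) y = ENNReal.ofReal
        (|M.det|⁻¹ * Real.exp (-(∑ i, (M⁻¹.mulVec y) i ^ 2) / 2)) := by
      rw [hμ, hd]
      exact Measure.rnDeriv_withDensity _ (by fun_prop)
    filter_upwards [hac.ae_le h] with y hy
    rw [density, hy, ENNReal.toReal_ofReal (by positivity), Real.log_mul (by positivity)
      (Real.exp_pos _).ne', Real.log_exp, Real.log_inv]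
    ring
  have hsq : ∀ i : ι, Integrable (fun x : ι → ℝ => x i ^ 2) (stdGaussian ι) := fun i =>
    integrable_comp_eval (μ := fun _ : ι => ProbabilityTheory.gaussianReal 0 1) (i := i)
      integrable_sq_gaussianReal
  have hlogm : Measurable fun y => Real.log (density μ y) :=
    Real.measurable_log.comp (measurable_density μ)
  have hcomp : (fun x => Real.log (density μ (M.mulVec x))) =ᵐ[stdGaussian ι]
      fun x => -(∑ i, x i ^ 2) / 2 - Real.log |M.det| := by
    filter_upwards [ae_of_ae_map hg.aemeasurable hdens] with x hx
    rw [hx, Matrix.mulVec_mulVec, Matrix.nonsing_inv_mul M hu, Matrix.one_mulVec]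
  have hsum : Integrable (fun x : ι → ℝ => -(∑ i, x i ^ 2) / 2) (stdGaussian ι) :=
    (integrable_finsetSum _ fun i _ => hsq i).neg.div_const 2
  have hint : Integrable (fun y => Real.log (density μ y)) μ :=
    (integrable_map_measure hlogm.aestronglyMeasurable hg.aemeasurable).2
      ((hsum.sub (integrable_const _)).congr hcomp.symm)
  refine ⟨⟨hac, entropyPos_ne_top_of_integrable hint, entropyNeg_ne_top_of_integrable hint⟩, ?_⟩
  rw [entropy_eq_of_integrable hint, hμ, integral_map hg.aemeasurable
    hlogm.aestronglyMeasurable, integral_congr_ae hcomp, integral_sub hsum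
    (integrable_const _), integral_div, integral_neg, integral_finsetSum _ fun i _ => hsq i]
  have hone : ∀ i : ι, ∫ x : ι → ℝ, x i ^ 2 ∂stdGaussian ι = 1 := fun i =>
    (integral_comp_eval (μ := fun _ : ι => ProbabilityTheory.gaussianReal 0 1) (i := i)
      (f := fun t : ℝ => t ^ 2) (by fun_prop)).trans integral_sq_gaussianReal
  simp only [hone]
  congr 1
  simp
  ring

/-! ### Gaussian lower bounds for the constant -/

theorem map_linearCombination_gaussianReal (a b : ℝ) :
    ((ProbabilityTheory.gaussianReal 0 1).prod (ProbabilityTheory.gaussianReal 0 1)).map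
      (fun z => a * z.1 + b * z.2)
      = ProbabilityTheory.gaussianReal 0 (a ^ 2 + b ^ 2).toNNReal := by
  have h := ProbabilityTheory.gaussianReal_conv_gaussianReal (m₁ := 0) (m₂ := 0)
    (v₁ := (a ^ 2).toNNReal) (v₂ := (b ^ 2).toNNReal)
  have hs : ∀ c : ℝ, (ProbabilityTheory.gaussianReal 0 1).map (c * ·)
      = ProbabilityTheory.gaussianReal 0 (c ^ 2).toNNReal := fun c => by
    rw [ProbabilityTheory.gaussianReal_map_const_mul, mul_zero, mul_one,
      Real.toNNReal_of_nonneg (sq_nonneg c)]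
  rw [Real.toNNReal_add (sq_nonneg a) (sq_nonneg b), ← add_zero (0 : ℝ), ← h, ← hs, ← hs,
    Measure.conv, Measure.map_prod_map _ _ (by fun_prop) (by fun_prop),
    Measure.map_map (by fun_prop) (by fun_prop)]
  simp only [add_zero]
  rfl

theorem map_linearCombination_stdGaussian (n : ℕ) (a b : ℝ) :
    (stdGaussian (Fin n ⊕ Fin n)).map (fun z j => a * z (Sum.inl j) + b * z (Sum.inr j))
      = Measure.pi fun _ : Fin n => ProbabilityTheory.gaussianReal 0 (a ^ 2 + b ^ 2).toNNReal := by
  have h1 := (measurePreserving_arrowProdEquivProdArrow ℝ ℝ (Fin n)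
    (fun _ => ProbabilityTheory.gaussianReal 0 1) (fun _ => ProbabilityTheory.gaussianReal 0 1))
  have h2 := measurePreserving_sumPiEquivProdPi_symm
    (fun _ : Fin n ⊕ Fin n => ProbabilityTheory.gaussianReal 0 1)
  have h3 := (h2.comp h1).map_eq
  rw [stdGaussian, ← h3, Measure.map_map (by fun_prop) (h2.comp h1).measurable,
    ← funext fun _ : Fin n => map_linearCombination_gaussianReal a b,
    ← Measure.pi_map_pi fun _ => by fun_prop]
  rfl

/-- A linear combination of independent standard Gaussian vectors is a multiple of one such
vector. -/
theorem map_linearCombination_stdGaussian_eq_map_mulVec (n : ℕ) {a b σ : ℝ}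
    (hσ : σ ^ 2 = a ^ 2 + b ^ 2) :
    (stdGaussian (Fin n ⊕ Fin n)).map (fun z j => a * z (Sum.inl j) + b * z (Sum.inr j))
      = (stdGaussian (Fin n)).map (σ • (1 : Matrix (Fin n) (Fin n) ℝ)).mulVec := by
  have hs : (ProbabilityTheory.gaussianReal 0 1).map (σ * ·)
      = ProbabilityTheory.gaussianReal 0 (a ^ 2 + b ^ 2).toNNReal := by
    rw [ProbabilityTheory.gaussianReal_map_const_mul, mul_zero, mul_one, ← hσ,
      Real.toNNReal_of_nonneg (sq_nonneg σ)]
  have hf : (σ • (1 : Matrix (Fin n) (Fin n) ℝ)).mulVec = fun z j => σ * z j := by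
    funext z j
    simp [Matrix.smul_mulVec]
  rw [map_linearCombination_stdGaussian, hf, ← hs, stdGaussian,
    ← Measure.pi_map_pi fun _ => by fun_prop]

/-- The block matrix that sends independent standard Gaussian vectors `Z`, `Z'` to `a Z` and
`c Z + d Z'`. -/
noncomputable def gaussianMatrix (n : ℕ) (a c d : ℝ) :
    Matrix (Fin n ⊕ Fin n) (Fin n ⊕ Fin n) ℝ :=
  Matrix.fromBlocks (a • 1) 0 (c • 1) (d • 1)

theorem det_gaussianMatrix (n : ℕ) (a c d : ℝ) : (gaussianMatrix n a c d).det = a ^ n * d ^ n := by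
  rw [gaussianMatrix, Matrix.det_fromBlocks_zero₁₂]
  simp

theorem standardDatum_image_gaussianMatrix (n : ℕ) (a c d : ℝ) {i : Fin 3} {σ : ℝ}
    (hσ : σ ^ 2 = form i a c ^ 2 + form i 0 d ^ 2) :
    (standardDatum n).image i ((stdGaussian (Fin n ⊕ Fin n)).map (gaussianMatrix n a c d).mulVec)
      = (stdGaussian (Fin n)).map (σ • (1 : Matrix (Fin n) (Fin n) ℝ)).mulVec := by
  rw [Datum.image, Measure.map_map (measurable_standardDatum_mulVec n i) (by fun_prop),
    ← map_linearCombination_stdGaussian_eq_map_mulVec n hσ]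
  congr 1
  funext z j
  have hz : (gaussianMatrix n a c d).mulVec z = Sum.elim (a • (z ∘ Sum.inl))
      (c • (z ∘ Sum.inl) + d • (z ∘ Sum.inr)) := by
    rw [gaussianMatrix, Matrix.fromBlocks_mulVec]
    simp [Matrix.smul_mulVec]
  rw [Function.comp_apply, hz, standardDatum_mulVec]
  fin_cases i <;> simp [form]
  ring

/-- The value of the Brascamp-Lieb functional at a Gaussian law with marginal standard deviations
`σ i`. -/
theorem gaussian_le_constant (n : ℕ) (p : Fin 3 → ℝ) {a c d : ℝ} (ha : 0 < a) (hd : 0 < d)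
    {σ : Fin 3 → ℝ} (hσ0 : ∀ i, 0 < σ i)
    (hσ : ∀ i, σ i ^ 2 = form i a c ^ 2 + form i 0 d ^ 2) :
    ((n + n * (Real.log a + Real.log d) - ∑ i, p i * (n / 2 + n * Real.log (σ i)) : ℝ) : EReal)
      ≤ (standardDatum n).constant p := by
  have hdet : (gaussianMatrix n a c d).det ≠ 0 := by rw [det_gaussianMatrix]; positivity
  obtain ⟨hfin, hent⟩ := entropy_map_mulVec_stdGaussian hdet
  set μ := (stdGaussian (Fin n ⊕ Fin n)).map (gaussianMatrix n a c d).mulVec with hμ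
  have himg : ∀ i, HasFiniteEntropy ((standardDatum n).image i μ) ∧
      entropy ((standardDatum n).image i μ)
        = ((n / 2 + n * Real.log (σ i) : ℝ) : EReal) := fun i => by
    have hdi : (σ i • (1 : Matrix (Fin n) (Fin n) ℝ)).det = σ i ^ n := by simp
    have h := entropy_map_mulVec_stdGaussian
      (M := σ i • (1 : Matrix (Fin n) (Fin n) ℝ)) (by rw [hdi]; exact (pow_pos (hσ0 i) n).ne')
    rw [hdi, abs_of_pos (pow_pos (hσ0 i) n), Real.log_pow, Fintype.card_fin,
      ← standardDatum_image_gaussianMatrix n a c d (hσ i)] at h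
    exact h
  have hadm : (standardDatum n).Admissible p μ :=
    { isProbabilityMeasure := Measure.isProbabilityMeasure_map (by fun_prop)
      hasFiniteEntropy := hfin
      hasEntropy_image := fun i _ => ⟨(himg i).1.1, Or.inl (himg i).1.2.1⟩
      not_indeterminate := by
        rintro ⟨i, j, _, _, h, _⟩
        rw [(himg i).2] at h
        exact EReal.coe_ne_top _ h }
  refine le_trans (le_of_eq ?_) (le_iSup₂ (f := fun μ (_ : (standardDatum n).Admissible p μ) =>
    entropy μ - ∑ i, (p i : EReal) * entropy ((standardDatum n).image i μ)) μ hadm)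
  simp only [(himg _).2, hent, det_gaussianMatrix, Fin.sum_univ_three, ← EReal.coe_mul,
    ← EReal.coe_add, ← EReal.coe_sub]
  rw [abs_of_pos (by positivity), Real.log_mul (by positivity) (by positivity), Real.log_pow,
    Real.log_pow, Fintype.card_sum, Fintype.card_fin]
  congr 1
  push_cast
  ring

/-- The lower bound from the Gaussian law with covariance `exp (2 s) • (diag(q) - q qᵀ)`, restricted
to the first two indices, where `q = 1 - r` is a probability vector. -/
theorem crossLog_le_constant (n : ℕ) (p : Fin 3 → ℝ) {r : Fin 3 → ℝ} (hr0 : ∀ i, 0 < r i)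
    (hr1 : ∀ i, r i < 1) (hr : r 0 + r 1 + r 2 = 2) (s : ℝ) :
    ((n / 2 * crossLog p r + (2 - (p 0 + p 1 + p 2)) * (n / 2 + n * s) : ℝ) : EReal)
      ≤ (standardDatum n).constant p := by
  have hq : ∀ i, 0 < 1 - r i := fun i => by linarith [hr1 i]
  have q0 := hq 0; have q1 := hq 1; have q2 := hq 2
  have r0 := hr0 0; have r1 := hr0 1; have r2 := hr0 2
  have hqr : ∀ i, 0 < (1 - r i) * r i := fun i => mul_pos (hq i) (hr0 i)
  have hA := Real.sqrt_pos.2 (hqr 0)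
  have hA2 := Real.sq_sqrt (hqr 0).le
  set A := √((1 - r 0) * r 0) with hAdef
  have hQ : 0 < (1 - r 0) * (1 - r 1) * (1 - r 2) := by positivity
  have hD := Real.sqrt_pos.2 hQ
  have hD2 := Real.sq_sqrt hQ.le
  set D := √((1 - r 0) * (1 - r 1) * (1 - r 2)) with hDdef
  have hsum : r 2 = 2 - r 0 - r 1 := by linarith
  have hexp := Real.exp_pos s
  have h := gaussian_le_constant n p (a := Real.exp s * A)
    (c := Real.exp s * (-((1 - r 0) * (1 - r 1)) / A)) (d := Real.exp s * (D / A))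
    (by positivity) (by positivity) (σ := fun i => Real.exp s * √((1 - r i) * r i))
    (fun i => mul_pos hexp (Real.sqrt_pos.2 (hqr i))) fun i => by
      rw [mul_pow, Real.sq_sqrt (hqr i).le]
      fin_cases i
      · simp [form, mul_pow, hA2]
      · simp only [form, Fin.mk_one, Matrix.cons_val, mul_pow, div_pow, hA2, hD2]
        rw [hsum]
        field_simp
        ring
      · simp only [form, Fin.reduceFinMk, Matrix.cons_val, zero_add, ← mul_add]
        have : A + -((1 - r 0) * (1 - r 1)) / A = (1 - r 0) * (1 - r 2) / A := by
          field_simp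
          rw [hA2, hsum]
          ring
        rw [this]
        simp only [mul_pow, div_pow, hA2, hD2]
        rw [hsum]
        field_simp
        ring
  refine le_trans (le_of_eq ?_) h
  have hlogσ : ∀ i, Real.log (Real.exp s * √((1 - r i) * r i))
      = s + (Real.log (1 - r i) + Real.log (r i)) / 2 := fun i => by
    rw [Real.log_mul hexp.ne' (Real.sqrt_pos.2 (hqr i)).ne', Real.log_exp,
      Real.log_sqrt (hqr i).le, Real.log_mul (hq i).ne' (hr0 i).ne']
  simp only [hlogσ]
  rw [Real.log_mul hexp.ne' hA.ne', Real.log_mul hexp.ne' (div_pos hD hA).ne', Real.log_exp,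
    Real.log_div hD.ne' hA.ne', hDdef, Real.log_sqrt hQ.le, Real.log_mul (by positivity) q2.ne',
    Real.log_mul q0.ne' q1.ne', crossLog]
  congr 1
  simp only [Fin.sum_univ_three]
  ring

theorem logConst_le_constant (n : ℕ) {p : Fin 3 → ℝ} (hp : ∀ i, p i ∈ Set.Icc (0 : ℝ) 1)
    (hsum : p 0 + p 1 + p 2 = 2) :
    ((n / 2 * logConst p : ℝ) : EReal) ≤ (standardDatum n).constant p := by
  have hlim : Filter.Tendsto (fun ε => ((n / 2 * crossLog p (perturb p ε) : ℝ) : EReal))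
      (nhdsWithin 0 (Set.Ioi 0)) (nhds ((n / 2 * logConst p : ℝ) : EReal)) :=
    (continuous_coe_real_ereal.tendsto _).comp ((tendsto_crossLog_perturb p).const_mul _)
  refine le_of_tendsto hlim ?_
  filter_upwards [Ioo_mem_nhdsGT (zero_lt_one' ℝ)] with ε hε
  have h := crossLog_le_constant n p (perturb_pos hp hε) (perturb_lt_one hp hε)
    (perturb_sum hsum ε) 0
  rwa [hsum, sub_self, zero_mul, add_zero] at h

theorem eq_top_of_tendsto_atTop {α : Type*} {l : Filter α} [l.NeBot] {f : α → ℝ} {C : EReal}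
    (hf : Filter.Tendsto f l Filter.atTop) (h : ∀ᶠ x in l, (f x : EReal) ≤ C) : C = ⊤ :=
  top_unique (le_of_tendsto ((EReal.tendsto_coe_nhds_top_iff).2 hf) h)

/-- Without the scaling condition, dilations of one Gaussian law make the functional unbounded. -/
theorem constant_eq_top_of_sum_ne {n : ℕ} (hn : 1 ≤ n) {p : Fin 3 → ℝ}
    (hsum : p 0 + p 1 + p 2 ≠ 2) : (standardDatum n).constant p = ⊤ := by
  have hn' : (0 : ℝ) < n := by exact_mod_cast hn
  have hδ : 2 - (p 0 + p 1 + p 2) ≠ 0 := sub_ne_zero.2 hsum.symm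
  set δ := 2 - (p 0 + p 1 + p 2) with hδdef
  have hlim : Filter.Tendsto (fun x : ℝ => n / 2 * crossLog p (fun _ => 2 / 3) + δ * (n / 2)
      + n * x) Filter.atTop Filter.atTop :=
    Filter.tendsto_atTop_add_const_left _ _ (Filter.tendsto_id.const_mul_atTop hn')
  refine eq_top_of_tendsto_atTop hlim (Filter.Eventually.of_forall fun x => ?_)
  have h := crossLog_le_constant n p (r := fun _ => 2 / 3) (fun _ => by norm_num)
    (fun _ => by norm_num) (by norm_num) (x / δ)
  refine le_trans (le_of_eq ?_) h
  congr 1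
  rw [← hδdef]
  field_simp
  ring

/-- If `p k > 1`, then Gaussian laws whose `k`-th marginal degenerates make the functional
unbounded. -/
theorem constant_eq_top_of_one_lt {n : ℕ} (hn : 1 ≤ n) {p : Fin 3 → ℝ}
    (hsum : p 0 + p 1 + p 2 = 2) {k : Fin 3} (hk : 1 < p k) : (standardDatum n).constant p = ⊤ := by
  have hn' : (0 : ℝ) < n / 2 := half_pos (by exact_mod_cast hn)
  set r : ℝ → Fin 3 → ℝ := fun ε => Function.update (fun _ => (1 + ε) / 2) k (1 - ε) with hr
  have hrk : ∀ ε, r ε k = 1 - ε := fun ε => by simp [hr]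
  have hrj : ∀ ε j, j ≠ k → r ε j = (1 + ε) / 2 := fun ε j hj => by simp [hr, hj]
  have hlim : Filter.Tendsto (fun ε => crossLog p (r ε)) (nhdsWithin 0 (Set.Ioi 0))
      Filter.atTop := by
    have heq : ∀ ε, crossLog p (r ε) = (1 - p k) * Real.log ε + (-(p k * Real.log (1 - ε))
        + ∑ j ∈ Finset.univ.erase k, ((1 - p j) * Real.log ((1 - ε) / 2)
          - p j * Real.log ((1 + ε) / 2))) := fun ε => by
      rw [crossLog, ← Finset.add_sum_erase _ _ (Finset.mem_univ k), hrk, sub_sub_cancel,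
        sub_eq_add_neg, add_assoc]
      congr 2
      refine Finset.sum_congr rfl fun j hj => ?_
      rw [hrj ε j (Finset.ne_of_mem_erase hj)]
      congr 3
      ring
    simp only [heq]
    refine Filter.Tendsto.atTop_add (C := -(p k * Real.log (1 - 0))
        + ∑ j ∈ Finset.univ.erase k, ((1 - p j) * Real.log ((1 - 0) / 2)
          - p j * Real.log ((1 + 0) / 2)))
      (Real.tendsto_log_nhdsGT_zero.const_mul_atBot_of_neg (by linarith)) ?_
    refine Filter.Tendsto.mono_left ?_ nhdsWithin_le_nhds
    have hc : ContinuousAt (fun ε : ℝ => -(p k * Real.log (1 - ε))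
        + ∑ j ∈ Finset.univ.erase k, ((1 - p j) * Real.log ((1 - ε) / 2)
          - p j * Real.log ((1 + ε) / 2))) 0 := by
      have h1 : ContinuousAt (fun ε : ℝ => Real.log (1 - ε)) 0 :=
        ContinuousAt.log (by fun_prop) (by norm_num)
      have h2 : ContinuousAt (fun ε : ℝ => Real.log ((1 - ε) / 2)) 0 :=
        ContinuousAt.log (by fun_prop) (by norm_num)
      have h3 : ContinuousAt (fun ε : ℝ => Real.log ((1 + ε) / 2)) 0 :=
        ContinuousAt.log (by fun_prop) (by norm_num)
      fun_prop
    exact hc.tendsto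
  refine eq_top_of_tendsto_atTop (hlim.const_mul_atTop hn') ?_
  filter_upwards [Ioo_mem_nhdsGT (zero_lt_one' ℝ)] with ε hε
  have hcase : ∀ i, r ε i = 1 - ε ∨ r ε i = (1 + ε) / 2 := fun i => by
    rcases eq_or_ne i k with rfl | hi
    · exact Or.inl (hrk ε)
    · exact Or.inr (hrj ε i hi)
  have h := crossLog_le_constant n p (r := r ε)
    (fun i => by rcases hcase i with h | h <;> rw [h] <;> linarith [hε.1, hε.2])
    (fun i => by rcases hcase i with h | h <;> rw [h] <;> linarith [hε.1, hε.2])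
    (by
      have hs : ∑ i, r ε i = 2 := by
        rw [← Finset.add_sum_erase _ _ (Finset.mem_univ k), hrk,
          Finset.sum_congr rfl fun j hj => hrj ε j (Finset.ne_of_mem_erase hj), Finset.sum_const,
          Finset.card_erase_of_mem (Finset.mem_univ k)]
        simp
        ring
      rwa [Fin.sum_univ_three] at hs) 0
  rwa [hsum, sub_self, zero_mul, add_zero] at h

end BrascampLieb

theorem mainTheorem7 (n : ℕ) (hn : 1 ≤ n) (p : Fin 3 → ℝ) (hp : ∀ i, 0 ≤ p i) :
    (((∀ i, p i ∈ Set.Icc (0 : ℝ) 1) ∧ p 0 + p 1 + p 2 = 2) →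
      (BrascampLieb.standardDatum n).constant p =
        (((n : ℝ) / 2 * ∑ i, ((1 - p i) * Real.log (1 - p i) - p i * Real.log (p i)) : ℝ) :
          EReal)) ∧
    (¬ ((∀ i, p i ∈ Set.Icc (0 : ℝ) 1) ∧ p 0 + p 1 + p 2 = 2) →
      (BrascampLieb.standardDatum n).constant p = ⊤) := by
  refine ⟨fun h => le_antisymm (BrascampLieb.constant_standardDatum_le h.1 h.2)
    (BrascampLieb.logConst_le_constant n h.1 h.2), fun h => ?_⟩
  by_cases hsum : p 0 + p 1 + p 2 = 2
  · have hk : ∃ k, 1 < p k := by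
      by_contra! hle
      exact h ⟨fun i => ⟨hp i, hle i⟩, hsum⟩
    obtain ⟨k, hk⟩ := hk
    exact BrascampLieb.constant_eq_top_of_one_lt hn hsum hk
  · exact BrascampLieb.constant_eq_top_of_sum_ne hn hsum
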